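/- **Model.** Customers arrive at a single-server queue in a Poisson process of rate $\lambda>0$; service is first-come-first-served with exponential times of rate $\mu>0$. A service is successful with probability $q\in(0,1]$ and the customer then leaves with reward $e^{-\alpha W}$, where $W$ is the time she has spent in the system and $\alpha\ge 0$; otherwise the service fails. In the *N-case* a customer whose service fails always goes to the end of the queue. In the *R-case* she decides anew, by her joining strategy, whether to rejoin at the end of the queue or to leave (renege). Joining costs a fee $v\in\mathbb R$; balking is worth $0$. For $x\ge 0$ the threshold strategy $\mathcal T(x)$ joins, when this leads to position $i\ge1$, with probability $u^{(x)}(i)=1$ if $i\le\lfloor x\rfloor$, $x-\lfloor x\rfloor$ if $i=\lfloor x\rfloor+1$, and $0$ if $i\ge\lfloor x\rfloor+2$. Let $z^{(x)}_{i}$ be the expected payoff $\mathbb E[e^{-\alpha W}]-v$ in the N-case of a tagged customer who joins in position $i$ (so that $i$ customers are then present, herself included), when all other customers use $\mathcal T(x)$. Let $\widehat z^{\,(x)}_{i}$ be the corresponding payoff in the R-case, when the tagged customer uses threshold $\lfloor x\rfloor+1$ after joining and all others use $\mathcal T(x)$ for joining and rejoining. A number $x\ge0$ is an N-case *Nash equilibrium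 threshold* if joining with probability $u^{(x)}(i)$ is optimal in each position that can be offered when all others use $\mathcal T(x)$, that is, $u^{(x)}(i)\,z^{(x)}_i\ge r\,z^{(x)}_i$ for all $r\in[0,1]$ and $1\le i\le\lceil x\rceil+1$; the R-case notion is the same with $\widehat z^{\,(x)}_i$ in place of $z^{(x)}_i$. **Statement.** For identical parameters $\lambda,\mu,q,\alpha,v$: 1. If $\alpha>0$, $q<1$ and $z^{(0)}_1\ne 0$, then every N-case equilibrium threshold $x_e$ and every R-case equilibrium threshold $\widehat x_e$ satisfy $\widehat x_e\ge x_e$. 2. If $\alpha>0$, $q<1$ and $z^{(0)}_1=0$ (a customer is indifferent to joining an empty system), then in both cases the equilibrium thresholds are exactly the numbers in $[0,1]$, so that $\widehat x_e\ge x_e$ for the same choice in both cases. 3. If $\alpha=0$ or $q=1$, then the two cases have the same set of equilibrium thresholds. 4. Customers have a stronger incentive to join when reneging is permitted: $\widehat z^{\,(x)}_i\ge z^{(x)}_i$ for all $x\ge 0$ and $1\le i\le\lfloor x\rfloor+1$. -/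

import Mathlib

open MeasureTheory ProbabilityTheory Set

noncomputable section

namespace FeedbackQueue

/-- Joining probability `u^{(x)}(i)` of the threshold strategy `T(x)`: the probability with which a
customer following `T(x)` joins when this would put her in position `i`. -/
def joinProb (x : ℝ) (i : ℕ) : ℝ :=
  if i ≤ ⌊x⌋₊ then 1 else if i = ⌊x⌋₊ + 1 then x - ⌊x⌋₊ else 0

/-- State of the system as seen by a tagged customer: `queue i j` means that she is in position `i`
and that `j` customers are present in total (herself included); `served` means that she has left
after a successful service; `reneged` means that she has left after a failed service. -/
inductive State where
  | queue (i j : ℕ) : State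
  | served : State
  | reneged : State

/-- Whether the tagged customer is still in the system. -/
def State.InSystem : State → Prop
  | .queue _ _ => True
  | _ => False

/-- The randomness attached to one event epoch: the time since the previous epoch, and three
numbers in `[0,1]`, which decide the type of the event (arrival or service completion), a joining
or rejoining decision, and the success of a service. -/
abbrev Noise : Type := ℝ × ℝ × ℝ × ℝ

/-- Time between the previous event epoch and this one. -/
def Noise.time (w : Noise) : ℝ := w.1

/-- The event is an arrival; otherwise it is a service completion. -/
def Noise.IsArrival (lam mu : ℝ) (w : Noise) : Prop := w.2.1 < lam / (lam + mu)

/-- A customer whose joining probability is `p` decides to join. -/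
def Noise.Joins (p : ℝ) (w : Noise) : Prop := w.2.2.1 < p

/-- The service is successful. -/
def Noise.IsSuccess (q : ℝ) (w : Noise) : Prop := w.2.2.2 < q

/-- The uniform distribution on `[0,1]`. -/
def unif : Measure ℝ := volume.restrict (Icc 0 1)

/-- Law of the randomness at one epoch: an exponential time of rate `lam + mu` and three uniform
variables, all independent. -/
def noiseLaw (lam mu : ℝ) : Measure Noise :=
  (expMeasure (lam + mu)).prod (unif.prod (unif.prod unif))

/-- Law of the whole driving sequence: independent, identically distributed epochs. -/
def pathLaw (lam mu : ℝ) : Measure (ℕ → Noise) :=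
  Measure.infinitePi fun _ => noiseLaw lam mu

open Classical in
/-- One transition when customers cannot renege and all customers other than the tagged one join
according to `T(x)`. After a failed service a customer goes to the end of the queue. -/
def stepN (lam mu q x : ℝ) (w : Noise) : State → State
  | .queue i j =>
    if w.IsArrival lam mu then
      if w.Joins (joinProb x (j + 1)) then .queue i (j + 1) else .queue i j
    else if i = 1 then
      if w.IsSuccess q then .served else .queue j j
    else
      if w.IsSuccess q then .queue (i - 1) (j - 1) else .queue (i - 1) j
  | s => s

open Classical in
/-- One transition when customers can renege. All customers other than the tagged one follow `T(x)`,
both when they arrive and when they decide, after a failed service, whether to rejoin at the end of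
the queue. The tagged customer follows the integer threshold `y`: after a failed service she rejoins
if her position would be at most `y`, and otherwise leaves. -/
def stepR (lam mu q : ℝ) (y : ℕ) (x : ℝ) (w : Noise) : State → State
  | .queue i j =>
    if w.IsArrival lam mu then
      if w.Joins (joinProb x (j + 1)) then .queue i (j + 1) else .queue i j
    else if i = 1 then
      if w.IsSuccess q then .served else if j ≤ y then .queue j j else .reneged
    else
      if w.IsSuccess q then .queue (i - 1) (j - 1)
      else if w.Joins (joinProb x j) then .queue (i - 1) j else .queue (i - 1) (j - 1)
  | s => s

/-- The chain of states at the successive event epochs, started from `s`. -/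
def chain (step : Noise → State → State) (s : State) (ω : ℕ → Noise) : ℕ → State
  | 0 => s
  | k + 1 => step (ω k) (chain step s ω k)

open Classical in
/-- The time (possibly infinite) which the tagged customer spends in the system. -/
def sojourn (step : Noise → State → State) (s : State) (ω : ℕ → Noise) : ENNReal :=
  ∑' k, if (chain step s ω k).InSystem then ENNReal.ofReal (ω k).time else 0

open Classical in
/-- The discounted reward `exp (-α W)`, received on successful completion of service. -/
def reward (α : ℝ) (step : Noise → State → State) (s : State) (ω : ℕ → Noise) : ℝ :=
  if ∃ k, chain step s ω k = .served then Real.exp (-α * (sojourn step s ω).toReal) else 0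

/-- `z_{i,i}^{(x)}(α)`: expected payoff, with admission fee `v`, of a tagged customer who joins in
position `i` when customers cannot renege and all others use `T(x)`. -/
def payoffN (lam mu q α v x : ℝ) (i : ℕ) : ℝ :=
  (∫ ω, reward α (stepN lam mu q x) (.queue i i) ω ∂(pathLaw lam mu)) - v

/-- `ẑ_{i,i}^{(y,x)}(α)`: expected payoff, with admission fee `v`, of a tagged customer who joins in
position `i` and uses the threshold `y` afterwards, when customers can renege and all others use
`T(x)`. -/
def payoffR (lam mu q α v : ℝ) (y : ℕ) (x : ℝ) (i : ℕ) : ℝ :=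
  (∫ ω, reward α (stepR lam mu q y x) (.queue i i) ω ∂(pathLaw lam mu)) - v

/-- `T(x)` is a best response: no customer gains by joining with another probability `r` in a
position `i` that she may be offered when all others use `T(x)`. As at most `⌈x⌉` others are then
present, these are the positions `1, …, ⌈x⌉ + 1`. Joining in position `i` is worth `payoff i`,
balking is worth `0`. -/
def IsBestResponse (payoff : ℕ → ℝ) (x : ℝ) : Prop :=
  ∀ i : ℕ, 1 ≤ i → i ≤ ⌈x⌉₊ + 1 → ∀ r ∈ Icc (0 : ℝ) 1, r * payoff i ≤ joinProb x i * payoff i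

/-- The Nash equilibrium thresholds when customers cannot renege. -/
def nashN (lam mu q α v : ℝ) : Set ℝ :=
  {x | 0 ≤ x ∧ IsBestResponse (payoffN lam mu q α v x) x}

/-- The Nash equilibrium thresholds when customers can renege. -/
def nashR (lam mu q α v : ℝ) : Set ℝ :=
  {x | 0 ≤ x ∧ IsBestResponse (payoffR lam mu q α v (⌊x⌋₊ + 1) x) x}

end FeedbackQueue

end

noncomputable section

namespace FeedbackQueue

open Filter Topology

/-! Conditioning on the first epoch exhibits the expected reward as the limit of finite-horizon
values obeying a Bellman recursion (`tendsto_value`). The N-case and the R-case share this recursion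
and differ only in the rejoining probabilities, so comparisons become inductions on the horizon.

In the N-case it is worse to be further back or to have more customers present
(`valueN_antitone_aux`). Hence the reward falls when others join more (`valueN_antitone_join`) and
rises when they may leave after a failure (`valueN_le_value`), which is the incentive claim. With
discounting and failures the gain is strict in position `⌊x⌋₊ + 1` for `1 ≤ x`
(`IsValue.lt_of_reneging`).

Suppose equilibria satisfied `xR < xN`. Position `⌊xR⌋₊ + 1` is joined with positive probability
under `xN`, so its N-payoff is nonnegative; it is joined with probability below one under `xR`, so
its R-payoff is nonpositive. If `1 ≤ xR`, monotonicity in the threshold and the strict gain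
contradict this. If `xR < 1`, the position is the first, where the R-reward is `soloReward`, that of
a customer who is always alone. This constant bounds every reward, and with discounting and failures
position 1 attains it exactly for thresholds in `[0, 1]`. So either a contradiction arises at once
or `v` equals `soloReward`, the indifferent case, which the same constant settles. If `α = 0`, both
rewards are 1 in all relevant positions; if `q = 1`, rejoining never happens. -/

instance : MeasurableSpace State := ⊤

instance : Countable State := by
  let f : State → Option (Option (ℕ × ℕ)) := fun s => match s with
    | .queue i j => some (some (i, j))
    | .served => some none
    | .reneged => none
  refine Function.Injective.countable (f := f) ?_
  rintro (⟨i, j⟩ | _ | _) (⟨i', j'⟩ | _ | _) h <;> simp_all [f]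

/-! ### Rewards along a path, and their truncation to finitely many epochs. -/

/-- The sequence of epochs after the first one. -/
def shift (ω : ℕ → Noise) : ℕ → Noise := fun k => ω (k + 1)

/-- Prepend an epoch to a sequence of epochs. -/
def prepend (z : Noise × (ℕ → Noise)) : ℕ → Noise
  | 0 => z.1
  | k + 1 => z.2 k

lemma shift_prepend (z : Noise × (ℕ → Noise)) : shift (prepend z) = z.2 := rfl

lemma measurable_prepend : Measurable prepend := by
  refine measurable_pi_iff.2 fun k => ?_
  cases k with
  | zero => exact measurable_fst
  | succ k => exact (measurable_pi_apply k).comp measurable_snd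

lemma measurable_shift : Measurable shift :=
  measurable_pi_iff.2 fun k => measurable_pi_apply (k + 1)

/-- The discount factor over one epoch. -/
def discount (α : ℝ) (w : Noise) : ℝ := Real.exp (-α * max w.time 0)

lemma discount_pos (α : ℝ) (w : Noise) : 0 < discount α w := Real.exp_pos _

lemma discount_le_one {α : ℝ} (hα : 0 ≤ α) (w : Noise) : discount α w ≤ 1 := by
  refine Real.exp_le_one_iff.2 ?_
  nlinarith [mul_nonneg hα (le_max_right w.time 0)]

lemma measurable_discount (α : ℝ) : Measurable (discount α) := by
  unfold discount Noise.time
  fun_prop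

/-- Once the tagged customer has left the system, her state does not change. -/
def Absorbing (step : Noise → State → State) : Prop :=
  ∀ w, step w .served = .served ∧ step w .reneged = .reneged

open Classical in
/-- The discounted reward received within the first `n` epochs. -/
def truncReward (α : ℝ) (step : Noise → State → State) : ℕ → State → (ℕ → Noise) → ℝ
  | 0, s, _ => if s = .served then 1 else 0
  | n + 1, .queue i j, ω =>
    discount α (ω 0) * truncReward α step n (step (ω 0) (.queue i j)) (shift ω)
  | _ + 1, .served, _ => 1
  | _ + 1, .reneged, _ => 0

lemma truncReward_mem {α : ℝ} (hα : 0 ≤ α) (step : Noise → State → State) (n : ℕ) (s : State)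
    (ω : ℕ → Noise) : 0 ≤ truncReward α step n s ω ∧ truncReward α step n s ω ≤ 1 := by
  induction n generalizing s ω with
  | zero => unfold truncReward; split_ifs <;> simp
  | succ n ih =>
    cases s with
    | queue i j =>
      obtain ⟨h0, h1⟩ := ih (step (ω 0) (.queue i j)) (shift ω)
      exact ⟨mul_nonneg (discount_pos _ _).le h0,
        mul_le_one₀ (discount_le_one hα _) h0 h1⟩
    | served => simp [truncReward]
    | reneged => simp [truncReward]

lemma truncReward_served (α : ℝ) (step : Noise → State → State) (n : ℕ) (ω : ℕ → Noise) :
    truncReward α step n .served ω = 1 := by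
  cases n <;> simp [truncReward]

lemma truncReward_reneged (α : ℝ) (step : Noise → State → State) (n : ℕ) (ω : ℕ → Noise) :
    truncReward α step n .reneged ω = 0 := by
  cases n <;> simp [truncReward]

lemma chain_succ' (step : Noise → State → State) (s : State) (ω : ℕ → Noise) (k : ℕ) :
    chain step s ω (k + 1) = chain step (step (ω 0) s) (shift ω) k := by
  induction k with
  | zero => rfl
  | succ k ih => rw [chain, ih]; rfl

section Absorbing

variable {step : Noise → State → State}

lemma Absorbing.chain_served (h : Absorbing step) (ω : ℕ → Noise) (k : ℕ) :
    chain step .served ω k = .served := by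
  induction k with
  | zero => rfl
  | succ k ih => rw [chain, ih, (h _).1]

lemma Absorbing.chain_reneged (h : Absorbing step) (ω : ℕ → Noise) (k : ℕ) :
    chain step .reneged ω k = .reneged := by
  induction k with
  | zero => rfl
  | succ k ih => rw [chain, ih, (h _).2]

lemma Absorbing.chain_served_of_le (h : Absorbing step) {s : State} {ω : ℕ → Noise} {k m : ℕ}
    (hk : chain step s ω k = .served) (hm : k ≤ m) : chain step s ω m = .served := by
  induction m, hm using Nat.le_induction with
  | base => exact hk
  | succ m _ ih => rw [chain, ih, (h _).1]

/-- From the epoch of success on all terms vanish, so the series is a finite sum of finite times.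
Finiteness matters because `toReal` is additive only away from `⊤`. -/
lemma Absorbing.sojourn_ne_top (h : Absorbing step) {s : State} {ω : ℕ → Noise}
    (hs : ∃ k, chain step s ω k = .served) : sojourn step s ω ≠ ⊤ := by
  obtain ⟨k, hk⟩ := hs
  unfold sojourn
  rw [tsum_eq_sum (s := Finset.range k)]
  · refine ENNReal.sum_ne_top.2 fun m _ => ?_
    split_ifs <;> simp
  · intro m hm
    have := h.chain_served_of_le hk (by simpa using hm : k ≤ m)
    simp [this, State.InSystem]

lemma Absorbing.reward_served (h : Absorbing step) (α : ℝ) (ω : ℕ → Noise) :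
    reward α step .served ω = 1 := by
  have h0 : sojourn step .served ω = 0 := by
    simp [sojourn, h.chain_served, State.InSystem]
  have : ∃ k, chain step .served ω k = .served := ⟨0, rfl⟩
  simp [reward, this, h0]

lemma Absorbing.reward_reneged (h : Absorbing step) (α : ℝ) (ω : ℕ → Noise) :
    reward α step .reneged ω = 0 := by
  simp [reward, h.chain_reneged]

lemma exists_chain_queue_iff (i j : ℕ) (ω : ℕ → Noise) :
    (∃ k, chain step (.queue i j) ω k = .served) ↔
      ∃ k, chain step (step (ω 0) (.queue i j)) (shift ω) k = .served := by
  constructor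
  · rintro ⟨_ | k, hk⟩
    · simp [chain] at hk
    · exact ⟨k, by rw [← chain_succ', hk]⟩
  · rintro ⟨k, hk⟩
    exact ⟨k + 1, by rw [chain_succ', hk]⟩

lemma sojourn_queue (i j : ℕ) (ω : ℕ → Noise) :
    sojourn step (.queue i j) ω = ENNReal.ofReal (ω 0).time +
      sojourn step (step (ω 0) (.queue i j)) (shift ω) := by
  unfold sojourn
  rw [tsum_eq_zero_add' ENNReal.summable]
  congr 1
  · simp [chain, State.InSystem]
  · refine tsum_congr fun k => ?_
    rw [chain_succ']
    rfl

lemma Absorbing.reward_queue (h : Absorbing step) (α : ℝ) (i j : ℕ) (ω : ℕ → Noise) :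
    reward α step (.queue i j) ω =
      discount α (ω 0) * reward α step (step (ω 0) (.queue i j)) (shift ω) := by
  by_cases hs : ∃ k, chain step (step (ω 0) (.queue i j)) (shift ω) k = .served
  · have hs' := (exists_chain_queue_iff i j ω).2 hs
    -- `ENNReal.ofReal` truncates negative times just as the `max` in `discount` does, so the
    -- identity holds on every path, not only almost surely.
    rw [reward, if_pos hs', reward, if_pos hs, sojourn_queue,
      ENNReal.toReal_add ENNReal.ofReal_ne_top (h.sojourn_ne_top hs), ENNReal.toReal_ofReal',
      discount, ← Real.exp_add, mul_add]
  · have hs' := mt (exists_chain_queue_iff i j ω).1 hs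
    rw [reward, if_neg hs', reward, if_neg hs, mul_zero]

lemma Absorbing.truncReward_of_served (h : Absorbing step) (α : ℝ) {n : ℕ} {s : State}
    {ω : ℕ → Noise} (hs : chain step s ω n = .served) :
    truncReward α step n s ω = reward α step s ω := by
  induction n generalizing s ω with
  | zero =>
    have : s = .served := hs
    rw [this, h.reward_served, truncReward_served]
  | succ n ih =>
    cases s with
    | queue i j =>
      rw [h.reward_queue, truncReward, ih]
      rwa [← chain_succ']
    | served => rw [h.reward_served, truncReward_served]
    | reneged => rw [h.reward_reneged, truncReward_reneged]

lemma Absorbing.truncReward_of_not_served (h : Absorbing step) (α : ℝ) {n : ℕ} {s : State}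
    {ω : ℕ → Noise} (hs : chain step s ω n ≠ .served) : truncReward α step n s ω = 0 := by
  induction n generalizing s ω with
  | zero => simpa [truncReward, chain] using hs
  | succ n ih =>
    cases s with
    | queue i j =>
      rw [truncReward, ih, mul_zero]
      rwa [← chain_succ']
    | served => exact absurd (h.chain_served ω _) hs
    | reneged => rw [truncReward_reneged]

/-- The sequence is eventually constant: it equals the reward once service has succeeded, and is
identically zero if it never does. -/
lemma Absorbing.tendsto_truncReward (h : Absorbing step) (α : ℝ) (s : State) (ω : ℕ → Noise) :
    Tendsto (fun n => truncReward α step n s ω) atTop (𝓝 (reward α step s ω)) := by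
  by_cases hs : ∃ k, chain step s ω k = .served
  · obtain ⟨k, hk⟩ := hs
    refine tendsto_const_nhds.congr' ?_
    filter_upwards [eventually_ge_atTop k] with n hn
    exact (h.truncReward_of_served α (h.chain_served_of_le hk hn)).symm
  · have : reward α step s ω = 0 := by rw [reward, if_neg hs]
    rw [this]
    refine tendsto_const_nhds.congr fun n => ?_
    exact (h.truncReward_of_not_served α fun hn => hs ⟨n, hn⟩).symm

end Absorbing

lemma measurable_truncReward (α : ℝ) {step : Noise → State → State}
    (hstep : ∀ s, Measurable fun w => step w s) (n : ℕ) (s : State) :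
    Measurable (truncReward α step n s) := by
  induction n generalizing s with
  | zero => exact measurable_const
  | succ n ih =>
    cases s with
    | queue i j =>
      -- The next state is random; countability of `State` upgrades measurability for each fixed
      -- state to joint measurability.
      have h1 : Measurable fun z : (ℕ → Noise) × State => truncReward α step n z.2 z.1 :=
        measurable_from_prod_countable_left fun s => ih s
      have h2 : Measurable fun ω : ℕ → Noise => step (ω 0) (.queue i j) :=
        (hstep _).comp (measurable_pi_apply 0)
      exact ((measurable_discount α).comp (measurable_pi_apply 0)).mul
        (h1.comp (measurable_shift.prodMk h2))
    | served => simpa only [funext (truncReward_served α step (n + 1))] using measurable_const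
    | reneged => simpa only [funext (truncReward_reneged α step (n + 1))] using measurable_const

/-! ### Conditioning on the first epoch. -/

instance : IsProbabilityMeasure unif := ⟨by simp [unif]⟩

lemma isProbabilityMeasure_noiseLaw {lam mu : ℝ} (h : 0 < lam + mu) :
    IsProbabilityMeasure (noiseLaw lam mu) := by
  have := isProbabilityMeasure_expMeasure h
  unfold noiseLaw
  infer_instance

/-- An infinite product measure is determined by finite-dimensional boxes, and the preimage of a box
splits into a condition on the first epoch and a box for the remaining ones. -/
lemma map_prepend {lam mu : ℝ} (h : 0 < lam + mu) :
    ((noiseLaw lam mu).prod (pathLaw lam mu)).map prepend = pathLaw lam mu := by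
  have := isProbabilityMeasure_noiseLaw h
  have : IsProbabilityMeasure (pathLaw lam mu) := by unfold pathLaw; infer_instance
  refine Measure.eq_infinitePi _ fun s t ht => ?_
  rw [Measure.map_apply measurable_prepend
    (MeasurableSet.pi s.countable_toSet fun i _ => ht i)]
  classical
  let s' : Finset ℕ := s.preimage Nat.succ (Nat.succ_injective.injOn)
  have hpre : prepend ⁻¹' (Set.pi s t) =
      (if 0 ∈ s then t 0 else univ) ×ˢ (Set.pi s' fun k => t (k + 1)) := by
    ext z
    simp only [mem_preimage, Set.mem_pi, Finset.mem_coe, mem_prod, s', Finset.mem_preimage]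
    constructor
    · intro hz
      refine ⟨?_, fun k hk => hz (k + 1) hk⟩
      split_ifs with h0
      · exact hz 0 h0
      · trivial
    · rintro ⟨h0, h1⟩ (_ | k) hk
      · rw [if_pos hk] at h0; exact h0
      · exact h1 k hk
  rw [hpre, Measure.prod_prod, pathLaw, Measure.infinitePi_pi _ (fun k _ => ht (k + 1))]
  have himg : ∏ k ∈ s', noiseLaw lam mu (t (k + 1)) = ∏ k ∈ s.erase 0, noiseLaw lam mu (t k) := by
    have : s.erase 0 = s'.map ⟨Nat.succ, Nat.succ_injective⟩ := by
      ext k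
      cases k <;> simp [s']
    rw [this, Finset.prod_map]
    rfl
  rw [himg]
  split_ifs with h0
  · rw [Finset.mul_prod_erase s (fun k => noiseLaw lam mu (t k)) h0]
  · rw [measure_univ, one_mul, Finset.erase_eq_of_notMem h0]

lemma integral_pathLaw {lam mu : ℝ} (h : 0 < lam + mu) {F : (ℕ → Noise) → ℝ}
    (hF : Measurable F) {C : ℝ} (hC : ∀ ω, |F ω| ≤ C) :
    ∫ ω, F ω ∂(pathLaw lam mu) =
      ∫ w, ∫ ω, F (prepend (w, ω)) ∂(pathLaw lam mu) ∂(noiseLaw lam mu) := by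
  have := isProbabilityMeasure_noiseLaw h
  have : IsProbabilityMeasure (pathLaw lam mu) := by unfold pathLaw; infer_instance
  conv_lhs => rw [← map_prepend h]
  rw [integral_map measurable_prepend.aemeasurable hF.aestronglyMeasurable, integral_prod]
  exact Integrable.of_bound (hF.comp measurable_prepend).aestronglyMeasurable C
    (Eventually.of_forall fun z => hC _)

lemma integral_unif_ite {p : ℝ} (hp : p ∈ Icc (0 : ℝ) 1) (a b : ℝ) :
    ∫ t, (if t < p then a else b) ∂unif = p * a + (1 - p) * b := by
  have h : (fun t : ℝ => if t < p then a else b) =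
      fun t => (Iio p).indicator (fun _ => a - b) t + b := by
    funext t
    by_cases ht : t < p <;> simp [indicator, ht]
  have hm : unif.real (Iio p) = p := by
    have : Iio p ∩ Icc 0 1 = Ico 0 p := by
      ext t
      simp only [mem_inter_iff, mem_Iio, mem_Icc, mem_Ico]
      have := hp.2
      constructor
      · rintro ⟨h1, h2, -⟩; exact ⟨h2, h1⟩
      · rintro ⟨h1, h2⟩; exact ⟨h2, h1, by linarith⟩
    rw [Measure.real, unif, Measure.restrict_apply measurableSet_Iio, this, Real.volume_Ico,
      sub_zero, ENNReal.toReal_ofReal hp.1]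
  rw [h, integral_add ((integrable_const _).indicator measurableSet_Iio) (integrable_const _),
    integral_indicator_const _ measurableSet_Iio, hm]
  simp
  ring

open Classical in
/-- A transition that depends on whether the event is an arrival (probability `p`), whether the
arriving customer joins (probability `a`), whether the service is successful (probability `q`) and
whether the customer rejoins after a failure (probability `b`). -/
def branch (p a q b : ℝ) (s₁ s₂ s₃ s₄ s₅ : State) (w : Noise) : State :=
  if w.2.1 < p then if w.2.2.1 < a then s₁ else s₂
  else if w.2.2.2 < q then s₃ else if w.2.2.1 < b then s₄ else s₅

lemma measurable_branch (p a q b : ℝ) (s₁ s₂ s₃ s₄ s₅ : State) :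
    Measurable (branch p a q b s₁ s₂ s₃ s₄ s₅) := by
  have h1 : MeasurableSet {w : Noise | w.2.1 < p} :=
    measurableSet_lt (by fun_prop) measurable_const
  have h2 (a : ℝ) : MeasurableSet {w : Noise | w.2.2.1 < a} :=
    measurableSet_lt (by fun_prop) measurable_const
  have h3 : MeasurableSet {w : Noise | w.2.2.2 < q} :=
    measurableSet_lt (by fun_prop) measurable_const
  exact Measurable.ite h1 (Measurable.ite (h2 a) measurable_const measurable_const)
    (Measurable.ite h3 measurable_const (Measurable.ite (h2 b) measurable_const measurable_const))

lemma integral_branch {lam mu α : ℝ} (h : 0 < lam + mu) {p a q b : ℝ}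
    (hp : p ∈ Icc (0 : ℝ) 1) (ha : a ∈ Icc (0 : ℝ) 1) (hq : q ∈ Icc (0 : ℝ) 1)
    (hb : b ∈ Icc (0 : ℝ) 1) (s₁ s₂ s₃ s₄ s₅ : State) (F : State → ℝ) :
    ∫ w, discount α w * F (branch p a q b s₁ s₂ s₃ s₄ s₅ w) ∂(noiseLaw lam mu) =
      (∫ t, Real.exp (-α * max t 0) ∂(expMeasure (lam + mu))) *
        (p * (a * F s₁ + (1 - a) * F s₂) +
          (1 - p) * (q * F s₃ + (1 - q) * (b * F s₄ + (1 - b) * F s₅))) := by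
  have := isProbabilityMeasure_expMeasure h
  have e0 : (∫ w, discount α w * F (branch p a q b s₁ s₂ s₃ s₄ s₅ w) ∂(noiseLaw lam mu)) =
      ∫ w : ℝ × ℝ × ℝ × ℝ, Real.exp (-α * max w.1 0) *
        F (branch p a q b s₁ s₂ s₃ s₄ s₅ (0, w.2))
          ∂((expMeasure (lam + mu)).prod (unif.prod (unif.prod unif))) := rfl
  have hmeas (G : Noise → State) (hG : Measurable G) : Measurable fun w => F (G w) :=
    (measurable_of_countable F).comp hG
  obtain ⟨C, hC⟩ : ∃ C, ∀ w, |F (branch p a q b s₁ s₂ s₃ s₄ s₅ w)| ≤ C := by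
    refine ⟨|F s₁| + |F s₂| + |F s₃| + |F s₄| + |F s₅|, fun w => ?_⟩
    have h1 := abs_nonneg (F s₁)
    have h2 := abs_nonneg (F s₂)
    have h3 := abs_nonneg (F s₃)
    have h4 := abs_nonneg (F s₄)
    have h5 := abs_nonneg (F s₅)
    unfold branch
    split_ifs <;> linarith
  have hB := hmeas _ (measurable_branch p a q b s₁ s₂ s₃ s₄ s₅)
  rw [e0, integral_prod_mul (fun t : ℝ => Real.exp (-α * max t 0))
    (fun v : ℝ × ℝ × ℝ => F (branch p a q b s₁ s₂ s₃ s₄ s₅ (0, v)))]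
  congr 1
  rw [integral_prod _ (Integrable.of_bound
    (f := fun v : ℝ × ℝ × ℝ => F (branch p a q b s₁ s₂ s₃ s₄ s₅ (0, v)))
    (hB.comp measurable_prodMk_left).aestronglyMeasurable C (Eventually.of_forall fun v => hC _))]
  have inner (t : ℝ) : (∫ v : ℝ × ℝ, F (branch p a q b s₁ s₂ s₃ s₄ s₅ (0, t, v))
      ∂(unif.prod unif)) = if t < p then a * F s₁ + (1 - a) * F s₂ else
        q * F s₃ + (1 - q) * (b * F s₄ + (1 - b) * F s₅) := by
    -- The success variable becomes the outer one, since the rejoining decision counts only after a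
    -- failure.
    rw [integral_prod_symm _ (Integrable.of_bound
      (f := fun v : ℝ × ℝ => F (branch p a q b s₁ s₂ s₃ s₄ s₅ (0, t, v)))
      (hB.comp (measurable_prodMk_left.comp measurable_prodMk_left)).aestronglyMeasurable C (Eventually.of_forall fun v => hC _))]
    split_ifs with ht
    · have (y x : ℝ) : F (branch p a q b s₁ s₂ s₃ s₄ s₅ (0, t, x, y)) =
          if x < a then F s₁ else F s₂ := by
        unfold branch; split_ifs <;> rfl
      simp only [this, integral_unif_ite ha]
      simp
    · have (y : ℝ) : ∫ x, F (branch p a q b s₁ s₂ s₃ s₄ s₅ (0, t, x, y)) ∂unif =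
          if y < q then F s₃ else b * F s₄ + (1 - b) * F s₅ := by
        rw [← integral_unif_ite hb]
        by_cases hy : y < q
        · simp [branch, ht, hy]
        · rw [if_neg hy]
          refine integral_congr_ae (Eventually.of_forall fun x => ?_)
          simp only [branch, ht, hy, if_false]
          split_ifs <;> rfl
      simp only [this, integral_unif_ite hq]
  simp only [inner, integral_unif_ite hp]

/-! ### The Bellman recursion for both cases. -/

/-- One step of the dynamic programming recursion for the expected reward from position `i` with
`j` customers present: an epoch is discounted by `β`, `p` is the probability of an arrival, `q` that
of a successful service, `u` and `w` are the joining and rejoining probabilities of the other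
customers and `c` is the rejoining probability of the tagged customer. -/
def bellman (β p q : ℝ) (u w c : ℕ → ℝ) (f : ℕ → ℕ → ℝ) (i j : ℕ) : ℝ :=
  β * (p * (u (j + 1) * f i (j + 1) + (1 - u (j + 1)) * f i j) +
    (1 - p) * (if i = 1 then q * 1 + (1 - q) * (c j * f j j)
      else q * f (i - 1) (j - 1) +
        (1 - q) * (w j * f (i - 1) j + (1 - w j) * f (i - 1) (j - 1))))

/-- The expected reward within `n` epochs. -/
def value (β p q : ℝ) (u w c : ℕ → ℝ) : ℕ → ℕ → ℕ → ℝ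
  | 0 => fun _ _ => 0
  | n + 1 => bellman β p q u w c (value β p q u w c n)

/-- The expected discount over one epoch. -/
def meanDiscount (lam mu α : ℝ) : ℝ := ∫ t, Real.exp (-α * max t 0) ∂(expMeasure (lam + mu))

/-- The step function of a chain with the dynamics that underlie `value`. -/
def HasDynamics (step : Noise → State → State) (p q : ℝ) (u w c : ℕ → ℝ) : Prop :=
  ∀ i j, ∃ b ∈ Icc (0 : ℝ) 1, ∃ s₄ s₅,
    ((fun z => step z (.queue i j)) =
      branch p (u (j + 1)) q b (.queue i (j + 1)) (.queue i j)
        (if i = 1 then .served else .queue (i - 1) (j - 1)) s₄ s₅) ∧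
    ∀ F : State → ℝ, F .reneged = 0 → b * F s₄ + (1 - b) * F s₅ =
      if i = 1 then c j * F (.queue j j)
      else w j * F (.queue (i - 1) j) + (1 - w j) * F (.queue (i - 1) (j - 1))

lemma integral_truncReward {lam mu α : ℝ} (h : 0 < lam + mu) (hα : 0 ≤ α)
    {step : Noise → State → State} (ha : Absorbing step) {p q : ℝ} {u w c : ℕ → ℝ}
    (hp : p ∈ Icc (0 : ℝ) 1) (hq : q ∈ Icc (0 : ℝ) 1) (hu : ∀ j, u j ∈ Icc (0 : ℝ) 1)
    (hs : HasDynamics step p q u w c) (n i j : ℕ) :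
    Measurable (truncReward α step n (.queue i j)) ∧
    ∫ ω, truncReward α step n (.queue i j) ω ∂(pathLaw lam mu) =
      value (meanDiscount lam mu α) p q u w c n i j := by
  have := isProbabilityMeasure_noiseLaw h
  have : IsProbabilityMeasure (pathLaw lam mu) := by unfold pathLaw; infer_instance
  have hstep (s : State) : Measurable fun z => step z s := by
    cases s with
    | queue i j =>
      obtain ⟨b, -, s₄, s₅, h, -⟩ := hs i j
      rw [h]
      exact measurable_branch _ _ _ _ _ _ _ _ _
    | served => simp only [(ha _).1]; exact measurable_const
    | reneged => simp only [(ha _).2]; exact measurable_const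
  refine ⟨measurable_truncReward α hstep n _, ?_⟩
  induction n generalizing i j with
  | zero => simp [truncReward, value]
  | succ n ih =>
    rw [integral_pathLaw h (measurable_truncReward α hstep (n + 1) (.queue i j)) (C := 1)
      fun ω => abs_le.2 ⟨by linarith [(truncReward_mem hα step (n + 1) (.queue i j) ω).1],
        (truncReward_mem hα step (n + 1) (.queue i j) ω).2⟩]
    let F : State → ℝ := fun s => ∫ ω, truncReward α step n s ω ∂(pathLaw lam mu)
    have hF (i j : ℕ) : F (.queue i j) = value (meanDiscount lam mu α) p q u w c n i j := ih i j
    have hF1 : F .served = 1 := by simp [F, truncReward_served]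
    have hF0 : F .reneged = 0 := by simp [F, truncReward_reneged]
    have key (z : Noise) : ∫ ω, truncReward α step (n + 1) (.queue i j) (prepend (z, ω))
        ∂(pathLaw lam mu) = discount α z * F (step z (.queue i j)) := by
      simp only [truncReward, shift_prepend, F]
      rw [← integral_const_mul]
      rfl
    simp only [key]
    obtain ⟨b, hb, s₄, s₅, hbr, hF45⟩ := hs i j
    have hs' (z : Noise) := congrFun hbr z
    simp only [hs']
    rw [integral_branch h hp (hu _) hq hb, hF45 F hF0, value, bellman, meanDiscount]
    split_ifs <;> simp only [hF, hF1, meanDiscount]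

lemma tendsto_value {lam mu α : ℝ} (h : 0 < lam + mu) (hα : 0 ≤ α)
    {step : Noise → State → State} (ha : Absorbing step) {p q : ℝ} {u w c : ℕ → ℝ}
    (hp : p ∈ Icc (0 : ℝ) 1) (hq : q ∈ Icc (0 : ℝ) 1) (hu : ∀ j, u j ∈ Icc (0 : ℝ) 1)
    (hs : HasDynamics step p q u w c) (i j : ℕ) :
    Tendsto (fun n => value (meanDiscount lam mu α) p q u w c n i j) atTop
      (𝓝 (∫ ω, reward α step (.queue i j) ω ∂(pathLaw lam mu))) := by
  have := isProbabilityMeasure_noiseLaw h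
  have : IsProbabilityMeasure (pathLaw lam mu) := by unfold pathLaw; infer_instance
  have key (n : ℕ) := integral_truncReward h hα ha hp hq hu hs n i j
  simp only [← fun n => (key n).2]
  refine tendsto_integral_of_dominated_convergence (fun _ => 1)
    (fun n => (key n).1.aestronglyMeasurable) (integrable_const _)
    (fun n => Eventually.of_forall fun ω => ?_)
    (Eventually.of_forall fun ω => ha.tendsto_truncReward α _ ω)
  obtain ⟨h0, h1⟩ := truncReward_mem hα step n (.queue i j) ω
  rw [Real.norm_eq_abs, abs_of_nonneg h0]
  exact h1

lemma joinProb_mem {x : ℝ} (hx : 0 ≤ x) (i : ℕ) : joinProb x i ∈ Icc (0 : ℝ) 1 := by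
  unfold joinProb
  have := Nat.floor_le hx
  have := Nat.lt_floor_add_one x
  split_ifs <;> constructor <;> linarith

lemma stepN_absorbing (lam mu q x : ℝ) : Absorbing (stepN lam mu q x) := fun _ => ⟨rfl, rfl⟩

lemma stepR_absorbing (lam mu q : ℝ) (y : ℕ) (x : ℝ) : Absorbing (stepR lam mu q y x) :=
  fun _ => ⟨rfl, rfl⟩

lemma stepN_hasDynamics (lam mu q x : ℝ) :
    HasDynamics (stepN lam mu q x) (lam / (lam + mu)) q (joinProb x) (fun _ => 1)
      (fun _ => 1) := by
  intro i j
  -- Rejoining is certain in the N-case, so both outcomes of the decision lead to the same state.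
  refine ⟨1, by simp, if i = 1 then .queue j j else .queue (i - 1) j,
    if i = 1 then .queue j j else .queue (i - 1) j, ?_, ?_⟩
  · funext z
    by_cases h₁ : z.2.1 < lam / (lam + mu) <;> by_cases h₂ : i = 1 <;>
      by_cases h₃ : z.2.2.2 < q <;> by_cases h₄ : z.2.2.1 < joinProb x (j + 1) <;>
      simp [stepN, branch, Noise.IsArrival, Noise.Joins, Noise.IsSuccess, h₁, h₂, h₃, h₄]
  · intro F _
    split_ifs <;> simp

lemma stepR_hasDynamics (lam mu q : ℝ) (y : ℕ) {x : ℝ} (hx : 0 ≤ x) :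
    HasDynamics (stepR lam mu q y x) (lam / (lam + mu)) q (joinProb x) (joinProb x)
      (fun j => if j ≤ y then 1 else 0) := by
  intro i j
  refine ⟨joinProb x j, joinProb_mem hx j,
    if i = 1 then if j ≤ y then .queue j j else .reneged else .queue (i - 1) j,
    if i = 1 then if j ≤ y then .queue j j else .reneged else .queue (i - 1) (j - 1), ?_, ?_⟩
  · funext z
    by_cases h₁ : z.2.1 < lam / (lam + mu) <;> by_cases h₂ : i = 1 <;>
      by_cases h₃ : z.2.2.2 < q <;> by_cases h₄ : z.2.2.1 < joinProb x (j + 1) <;>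
      by_cases h₅ : z.2.2.1 < joinProb x j <;>
      simp [stepR, branch, Noise.IsArrival, Noise.Joins, Noise.IsSuccess, h₁, h₂, h₃, h₄, h₅]
  · intro F hF
    by_cases h₁ : i = 1 <;> by_cases h₂ : j ≤ y <;> simp [h₁, h₂, hF]
    ring

/-! ### The expected discount of one epoch. -/

section MeanDiscount

variable {lam mu α : ℝ}

lemma integrable_discount (h : 0 < lam + mu) (hα : 0 ≤ α) :
    Integrable (fun t : ℝ => Real.exp (-α * max t 0)) (expMeasure (lam + mu)) := by
  have := isProbabilityMeasure_expMeasure h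
  refine Integrable.of_bound (by fun_prop) 1 (Eventually.of_forall fun t => ?_)
  rw [Real.norm_eq_abs, Real.abs_exp, Real.exp_le_one_iff]
  nlinarith [mul_nonneg hα (le_max_right t 0)]

lemma meanDiscount_pos (h : 0 < lam + mu) (hα : 0 ≤ α) : 0 < meanDiscount lam mu α := by
  have := isProbabilityMeasure_expMeasure h
  exact integral_exp_pos (integrable_discount h hα)

lemma meanDiscount_le_one (h : 0 < lam + mu) (hα : 0 ≤ α) : meanDiscount lam mu α ≤ 1 := by
  have := isProbabilityMeasure_expMeasure h
  have h1 := integral_mono (integrable_discount h hα) (integrable_const (1 : ℝ)) fun t => by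
    refine Real.exp_le_one_iff.2 ?_
    nlinarith [mul_nonneg hα (le_max_right t 0)]
  simpa [meanDiscount] using h1

lemma meanDiscount_zero (h : 0 < lam + mu) : meanDiscount lam mu 0 = 1 := by
  have := isProbabilityMeasure_expMeasure h
  simp [meanDiscount]

lemma meanDiscount_lt_one (h : 0 < lam + mu) (hα : 0 < α) : meanDiscount lam mu α < 1 := by
  have := isProbabilityMeasure_expMeasure h
  have h0 : expMeasure (lam + mu) (Iic 0) = 0 := by
    have := cdf_expMeasure_eq h 0
    rw [cdf_eq_real, if_pos le_rfl] at this
    simpa [measureReal_eq_zero_iff] using this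
  have hi : Integrable (fun t : ℝ => 1 - Real.exp (-α * max t 0)) (expMeasure (lam + mu)) :=
    (integrable_const _).sub (integrable_discount h hα.le)
  -- The integrand is nonnegative, and positive on the positive half-line, which carries all the
  -- mass.
  have h1 : 0 < ∫ t, (1 - Real.exp (-α * max t 0)) ∂(expMeasure (lam + mu)) := by
    rw [integral_pos_iff_support_of_nonneg _ hi]
    · refine lt_of_lt_of_le ?_ (measure_mono (s := (Iic 0)ᶜ) fun t ht => ?_)
      · rw [prob_compl_eq_one_sub measurableSet_Iic, h0]
        simp
      · have ht' : 0 < t := by simpa using ht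
        have : Real.exp (-α * max t 0) < 1 := by
          rw [max_eq_left ht'.le, Real.exp_lt_one_iff]
          nlinarith
        exact (sub_pos.2 this).ne'
    · intro t
      refine sub_nonneg.2 (Real.exp_le_one_iff.2 ?_)
      nlinarith [mul_nonneg hα.le (le_max_right t 0)]
  rw [integral_sub (integrable_const _) (integrable_discount h hα.le)] at h1
  simpa [meanDiscount] using h1

end MeanDiscount

/-! ### Inequalities between weighted means. -/

section Mix

variable {a b x y x' y' : ℝ}

lemma mix_le_mix (ha : a ∈ Icc (0 : ℝ) 1) (hx : x ≤ x') (hy : y ≤ y') :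
    a * x + (1 - a) * y ≤ a * x' + (1 - a) * y' :=
  add_le_add (mul_le_mul_of_nonneg_left hx ha.1)
    (mul_le_mul_of_nonneg_left hy (sub_nonneg.2 ha.2))

lemma mix_le (ha : a ∈ Icc (0 : ℝ) 1) (hx : x ≤ b) (hy : y ≤ b) : a * x + (1 - a) * y ≤ b :=
  (mix_le_mix ha hx hy).trans_eq (by ring)

lemma le_mix (ha : a ∈ Icc (0 : ℝ) 1) (hx : b ≤ x) (hy : b ≤ y) : b ≤ a * x + (1 - a) * y :=
  le_of_eq_of_le (by ring) (mix_le_mix ha hx hy)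

lemma mix_lt_mix_left (ha : a ∈ Icc (0 : ℝ) 1) (ha0 : 0 < a) (hx : x < x') (hy : y ≤ y') :
    a * x + (1 - a) * y < a * x' + (1 - a) * y' :=
  add_lt_add_of_lt_of_le (mul_lt_mul_of_pos_left hx ha0)
    (mul_le_mul_of_nonneg_left hy (sub_nonneg.2 ha.2))

lemma mix_lt_mix_right (ha : a ∈ Icc (0 : ℝ) 1) (ha1 : a < 1) (hx : x ≤ x') (hy : y < y') :
    a * x + (1 - a) * y < a * x' + (1 - a) * y' :=
  add_lt_add_of_le_of_lt (mul_le_mul_of_nonneg_left hx ha.1)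
    (mul_lt_mul_of_pos_left hy (sub_pos.2 ha1))

/-- Putting more weight on the smaller of two numbers decreases a weighted mean. -/
lemma mix_anti (hab : a ≤ b) (hxy : x ≤ y) : b * x + (1 - b) * y ≤ a * x + (1 - a) * y := by
  nlinarith [mul_nonneg (sub_nonneg.2 hab) (sub_nonneg.2 hxy)]

end Mix

/-! ### General bounds, and the customer who is always alone. -/

/-- The parameters of the recursion are admissible. -/
structure Admissible (β p q : ℝ) (u w c : ℕ → ℝ) : Prop where
  beta_pos : 0 < β
  beta_le : β ≤ 1
  arrival : p ∈ Icc (0 : ℝ) 1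
  arrival_lt : p < 1
  success : q ∈ Icc (0 : ℝ) 1
  success_pos : 0 < q
  join : ∀ j, u j ∈ Icc (0 : ℝ) 1
  rejoin : ∀ j, w j ∈ Icc (0 : ℝ) 1
  rejoin_tagged : ∀ j, c j ∈ Icc (0 : ℝ) 1

section General

variable {β p q : ℝ} {u w c : ℕ → ℝ}

lemma Admissible.value_mem (h : Admissible β p q u w c) (n i j : ℕ) :
    value β p q u w c n i j ∈ Icc (0 : ℝ) 1 := by
  induction n generalizing i j with
  | zero => simp [value]
  | succ n ih =>
    have hm {a x y : ℝ} (ha : a ∈ Icc (0 : ℝ) 1) (hx : x ∈ Icc (0 : ℝ) 1)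
        (hy : y ∈ Icc (0 : ℝ) 1) : a * x + (1 - a) * y ∈ Icc (0 : ℝ) 1 :=
      ⟨le_mix ha hx.1 hy.1, mix_le ha hx.2 hy.2⟩
    have hmul {a x : ℝ} (ha : a ∈ Icc (0 : ℝ) 1) (hx : x ∈ Icc (0 : ℝ) 1) :
        a * x ∈ Icc (0 : ℝ) 1 :=
      ⟨mul_nonneg ha.1 hx.1, mul_le_one₀ ha.2 hx.1 hx.2⟩
    refine hmul ⟨h.beta_pos.le, h.beta_le⟩ (hm h.arrival (hm (h.join _) (ih _ _) (ih _ _)) ?_)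
    split_ifs
    · exact hm h.success (by simp) (hmul (h.rejoin_tagged _) (ih _ _))
    · exact hm h.success (ih _ _) (hm (h.rejoin _) (ih _ _) (ih _ _))

/-- The expected reward of a customer who never meets other customers. -/
def soloValue (β p q : ℝ) : ℝ := β * (1 - p) * q / (1 - β * p - β * (1 - p) * (1 - q))

lemma Admissible.solo_denom_pos (h : Admissible β p q u w c) :
    0 < 1 - β * p - β * (1 - p) * (1 - q) := by
  have h1 : 0 < (1 - p) * q := mul_pos (sub_pos.2 h.arrival_lt) h.success_pos
  have h2 : 0 ≤ p + (1 - p) * (1 - q) := add_nonneg h.arrival.1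
    (mul_nonneg (sub_nonneg.2 h.arrival.2) (sub_nonneg.2 h.success.2))
  nlinarith [mul_nonneg (sub_nonneg.2 h.beta_le) h2]

lemma Admissible.soloValue_pos (h : Admissible β p q u w c) : 0 < soloValue β p q :=
  div_pos (mul_pos (mul_pos h.beta_pos (sub_pos.2 h.arrival_lt)) h.success_pos) h.solo_denom_pos

lemma Admissible.soloValue_le_one (h : Admissible β p q u w c) : soloValue β p q ≤ 1 := by
  rw [soloValue, div_le_one h.solo_denom_pos]
  linarith [h.beta_le]

lemma Admissible.soloValue_eq (h : Admissible β p q u w c) :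
    soloValue β p q = β * (p * soloValue β p q + (1 - p) * (q * 1 + (1 - q) * soloValue β p q)) := by
  have h0 := h.solo_denom_pos.ne'
  have h1 : soloValue β p q * (1 - β * p - β * (1 - p) * (1 - q)) = β * (1 - p) * q :=
    div_mul_cancel₀ _ h0
  linear_combination h1

/-- The constant `soloValue` is a supersolution of the recursion: it solves the equation in which
every successful service pays 1, and no branch pays more than that. -/
lemma Admissible.value_le_soloValue (h : Admissible β p q u w c) (n i j : ℕ) :
    value β p q u w c n i j ≤ soloValue β p q := by
  induction n generalizing i j with
  | zero => exact h.soloValue_pos.le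
  | succ n ih =>
    rw [h.soloValue_eq]
    refine mul_le_mul_of_nonneg_left ?_ h.beta_pos.le
    refine mix_le_mix h.arrival (mix_le (h.join _) (ih _ _) (ih _ _)) ?_
    split_ifs
    · refine mix_le_mix h.success le_rfl ((mul_le_of_le_one_left ?_ (h.rejoin_tagged _).2).trans
        (ih j j))
      exact (h.value_mem n j j).1
    · exact mix_le_mix h.success ((ih _ _).trans h.soloValue_le_one)
        (mix_le (h.rejoin _) (ih _ _) (ih _ _))

lemma value_congr_of_success {w' c' : ℕ → ℝ} (n : ℕ) :
    value β p 1 u w c n = value β p 1 u w' c' n := by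
  induction n with
  | zero => rfl
  | succ n ih =>
    funext i j
    simp only [value, bellman, ih, sub_self, zero_mul, add_zero]

/-- `f` is the expected reward over an infinite horizon. -/
def IsValue (β p q : ℝ) (u w c : ℕ → ℝ) (f : ℕ → ℕ → ℝ) : Prop :=
  ∀ i j, Tendsto (fun n => value β p q u w c n i j) atTop (𝓝 (f i j))

variable {f : ℕ → ℕ → ℝ}

lemma IsValue.eq_bellman (hf : IsValue β p q u w c f) (i j : ℕ) :
    f i j = bellman β p q u w c f i j := by
  refine tendsto_nhds_unique ((tendsto_add_atTop_iff_nat 1).2 (hf i j)) ?_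
  refine ((((hf _ _).const_mul _).add ((hf _ _).const_mul _)).const_mul _ |>.add
    (Tendsto.const_mul _ ?_)).const_mul _
  split_ifs
  · exact ((hf _ _).const_mul _ |>.const_mul _).const_add _
  · exact ((hf _ _).const_mul _).add
      ((((hf _ _).const_mul _).add ((hf _ _).const_mul _)).const_mul _)

lemma IsValue.mem (hf : IsValue β p q u w c f) (h : Admissible β p q u w c) (i j : ℕ) :
    f i j ∈ Icc (0 : ℝ) 1 :=
  isClosed_Icc.mem_of_tendsto (hf i j) (Eventually.of_forall fun n => h.value_mem n i j)

lemma IsValue.le_soloValue (hf : IsValue β p q u w c f) (h : Admissible β p q u w c)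
    (i j : ℕ) : f i j ≤ soloValue β p q :=
  le_of_tendsto' (hf i j) fun n => h.value_le_soloValue n i j

/-- Nobody joins behind her and she always rejoins alone, so the recursion at `(1, 1)` is a linear
equation in a single unknown. -/
lemma IsValue.eq_soloValue (hf : IsValue β p q u w c f) (h : Admissible β p q u w c)
    (hu : u 2 = 0) (hc : c 1 = 1) : f 1 1 = soloValue β p q := by
  have h1 := hf.eq_bellman 1 1
  simp only [bellman, Nat.reduceAdd, hu, hc, if_true] at h1
  rw [soloValue, eq_div_iff h.solo_denom_pos.ne']
  linear_combination h1

lemma IsValue.lt_soloValue (hf : IsValue β p q u w c f) (h : Admissible β p q u w c)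
    (hβ : β < 1) (hq : q < 1) (hp : 0 < p) (hu : 0 < u 2) : f 1 1 < soloValue β p q := by
  have hs := h.soloValue_eq
  have hle := hf.le_soloValue h
  have hcf (j : ℕ) : c j * f j j ≤ f j j :=
    mul_le_of_le_one_left (hf.mem h _ _).1 (h.rejoin_tagged _).2
  -- In position 2 no branch pays more than `soloValue`, so the factor `β < 1` is lost. The gap
  -- reaches `(1, 2)` through a failure and `(1, 1)` through an arrival that joins.
  have h22 : f 2 2 < soloValue β p q := by
    rw [hf.eq_bellman 2 2]
    refine lt_of_le_of_lt (mul_le_mul_of_nonneg_left (b := _) (c := soloValue β p q) ?_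
      h.beta_pos.le) (mul_lt_of_lt_one_left h.soloValue_pos hβ)
    refine mix_le h.arrival (mix_le (h.join _) (hle _ _) (hle _ _)) ?_
    rw [if_neg (by norm_num)]
    exact mix_le h.success (hle _ _) (mix_le (h.rejoin _) (hle _ _) (hle _ _))
  have h12 : f 1 2 < soloValue β p q := by
    rw [hf.eq_bellman 1 2, hs]
    refine mul_lt_mul_of_pos_left (mix_lt_mix_right h.arrival h.arrival_lt
      (mix_le (h.join _) (hle _ _) (hle _ _)) ?_) h.beta_pos
    rw [if_pos rfl]
    exact mix_lt_mix_right h.success hq le_rfl ((hcf 2).trans_lt h22)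
  rw [hf.eq_bellman 1 1, hs]
  refine mul_lt_mul_of_pos_left (mix_lt_mix_left h.arrival hp ?_ ?_) h.beta_pos
  · have := mix_lt_mix_left (h.join 2) hu h12 (hle 1 1)
    exact this.trans_eq (by ring)
  · rw [if_pos rfl]
    exact mix_le_mix h.success le_rfl ((hcf 1).trans (hle 1 1))

end General

/-! ### Monotonicity without reneging, and comparison with reneging. -/

/-- The expected reward over `n` epochs when all customers rejoin after a failure. -/
abbrev valueN (β p q : ℝ) (u : ℕ → ℝ) : ℕ → ℕ → ℕ → ℝ :=
  value β p q u (fun _ => 1) (fun _ => 1)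

section NoReneging

variable {β p q : ℝ} {u : ℕ → ℝ}

lemma bellman_no_reneging (f : ℕ → ℕ → ℝ) (i j : ℕ) :
    bellman β p q u (fun _ => 1) (fun _ => 1) f i j =
      β * (p * (u (j + 1) * f i (j + 1) + (1 - u (j + 1)) * f i j) +
        (1 - p) * (if i = 1 then q * 1 + (1 - q) * f j j
          else q * f (i - 1) (j - 1) + (1 - q) * f (i - 1) j)) := by
  simp [bellman]

lemma valueN_succ (n i j : ℕ) : valueN β p q u (n + 1) i j =
      β * (p * (u (j + 1) * valueN β p q u n i (j + 1) +
          (1 - u (j + 1)) * valueN β p q u n i j) +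
        (1 - p) * (if i = 1 then q * 1 + (1 - q) * valueN β p q u n j j
          else q * valueN β p q u n (i - 1) (j - 1) + (1 - q) * valueN β p q u n (i - 1) j)) :=
  bellman_no_reneging _ i j

/-- Being further ahead with fewer customers present is better. The second inequality compares a
customer who is served with one who is next to be served; it makes the induction work. -/
lemma valueN_antitone_aux (h : Admissible β p q u (fun _ => 1) (fun _ => 1)) (hu : Antitone u)
    (n : ℕ) :
    (∀ i j i' j', 1 ≤ i → i ≤ j → i' ≤ j' → i ≤ i' → j ≤ j' →
      valueN β p q u n i' j' ≤ valueN β p q u n i j) ∧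
    (∀ j, 1 ≤ j → q * valueN β p q u n 1 j + (1 - q) * valueN β p q u n 1 (j + 1) ≤
      q * 1 + (1 - q) * valueN β p q u n (j + 1) (j + 1)) := by
  induction n with
  | zero => simp [valueN, value, h.success_pos.le]
  | succ n ih =>
    obtain ⟨hM, hD⟩ := ih
    refine ⟨fun i j i' j' hi hij hij' hii hjj => ?_, fun j hj => ?_⟩
    · rw [valueN_succ, valueN_succ]
      refine mul_le_mul_of_nonneg_left (mix_le_mix h.arrival ?_ ?_) h.beta_pos.le
      · rcases hjj.eq_or_lt with rfl | hlt
        · exact mix_le_mix (h.join _) (hM _ _ _ _ hi (by omega) (by omega) hii le_rfl)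
            (hM _ _ _ _ hi hij hij' hii le_rfl)
        -- As `j + 1 ≤ j'`, the value at `(i', j')` separates the two means, so their joining
        -- probabilities need not be compared.
        · refine (mix_le (h.join _) (hM i' j' _ _ (by omega) hij' (by omega) le_rfl (by omega))
            le_rfl).trans (le_mix (h.join _) ?_ ?_)
          · exact hM _ _ _ _ hi (by omega) hij' hii hlt
          · exact hM _ _ _ _ hi hij hij' hii hjj
      · by_cases h1 : i = 1
        · rw [if_pos h1]
          by_cases h1' : i' = 1
          · rw [if_pos h1']
            exact mix_le_mix h.success le_rfl (hM _ _ _ _ (by omega) le_rfl le_rfl hjj hjj)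
          · rw [if_neg h1']
            have hj' : j' - 1 + 1 = j' := by omega
            -- One customer is in service and the other is not: the second inequality bridges this,
            -- after moving the latter up to position 1.
            have h2 := hD (j' - 1) (by omega)
            rw [hj'] at h2
            refine (mix_le_mix h.success ?_ ?_).trans (h2.trans (mix_le_mix h.success le_rfl ?_))
            · exact hM _ _ _ _ le_rfl (by omega) (by omega) (by omega) le_rfl
            · exact hM _ _ _ _ le_rfl (by omega) (by omega) (by omega) le_rfl
            · exact hM _ _ _ _ (by omega) le_rfl le_rfl hjj hjj
        · rw [if_neg h1, if_neg (by omega)]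
          exact mix_le_mix h.success
            (hM _ _ _ _ (by omega) (by omega) (by omega) (by omega) (by omega))
            (hM _ _ _ _ (by omega) (by omega) (by omega) (by omega) hjj)
    · have hA : q * (u (j + 1) * valueN β p q u n 1 (j + 1) +
            (1 - u (j + 1)) * valueN β p q u n 1 j) +
          (1 - q) * (u (j + 2) * valueN β p q u n 1 (j + 2) +
            (1 - u (j + 2)) * valueN β p q u n 1 (j + 1)) ≤
          q * 1 + (1 - q) * (u (j + 2) * valueN β p q u n (j + 1) (j + 2) +
            (1 - u (j + 2)) * valueN β p q u n (j + 1) (j + 1)) := by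
        -- Lowering the weight `u (j + 1)` to `u (j + 2)` gives both means the same weights; then
        -- `hD` at `j + 1` and at `j` can be mixed.
        have h1 := mix_anti (hu (by omega : j + 1 ≤ j + 2))
          (hM 1 j 1 (j + 1) le_rfl hj (by omega) le_rfl (by omega))
        have h2 : q * valueN β p q u n 1 (j + 1) + (1 - q) * valueN β p q u n 1 (j + 2) ≤
            q * 1 + (1 - q) * valueN β p q u n (j + 1) (j + 2) :=
          (hD (j + 1) (by omega)).trans (mix_le_mix h.success le_rfl
            (hM _ _ _ _ (by omega) (by omega) (by omega) (by omega) le_rfl))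
        have h3 := mix_le_mix (h.join (j + 2)) h2 (hD j hj)
        have h4 := mul_le_mul_of_nonneg_left h1 h.success.1
        linarith
      have hS : q * (q * 1 + (1 - q) * valueN β p q u n j j) +
          (1 - q) * (q * 1 + (1 - q) * valueN β p q u n (j + 1) (j + 1)) ≤
          q * 1 + (1 - q) * (q * valueN β p q u n j j +
            (1 - q) * valueN β p q u n j (j + 1)) := by
        have h1 := hM j (j + 1) (j + 1) (j + 1) hj (by omega) le_rfl (by omega) le_rfl
        have h2 := mul_le_mul_of_nonneg_left (mul_le_mul_of_nonneg_left h1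
          (sub_nonneg.2 h.success.2)) (sub_nonneg.2 h.success.2)
        linarith
      have hAS := mul_le_mul_of_nonneg_left (mix_le_mix h.arrival hA hS) h.beta_pos.le
      -- The immediate reward `q` on the right is not discounted, whereas `hAS` only supplies `β *
      -- q`.
      have hβq := mul_le_mul_of_nonneg_right h.beta_le h.success.1
      simp only [valueN_succ, if_true, if_neg (by omega : ¬ j + 1 = 1), Nat.add_sub_cancel]
      linarith

lemma valueN_antitone (h : Admissible β p q u (fun _ => 1) (fun _ => 1)) (hu : Antitone u)
    (n : ℕ) {i j i' j' : ℕ} (hi : 1 ≤ i) (hij : i ≤ j) (hij' : i' ≤ j') (hii : i ≤ i')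
    (hjj : j ≤ j') : valueN β p q u n i' j' ≤ valueN β p q u n i j :=
  (valueN_antitone_aux h hu n).1 i j i' j' hi hij hij' hii hjj

/-- The expected reward decreases in the joining probabilities of the other customers. -/
lemma valueN_antitone_join (h : Admissible β p q u (fun _ => 1) (fun _ => 1)) (hu : Antitone u)
    {u' : ℕ → ℝ} (h' : Admissible β p q u' (fun _ => 1) (fun _ => 1)) (huu : u ≤ u')
    (n : ℕ) {i j : ℕ} (hi : 1 ≤ i) (hij : i ≤ j) :
    valueN β p q u' n i j ≤ valueN β p q u n i j := by
  induction n generalizing i j with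
  | zero => exact le_rfl
  | succ n ih =>
    rw [valueN_succ, valueN_succ]
    refine mul_le_mul_of_nonneg_left (mix_le_mix h.arrival ?_ ?_) h.beta_pos.le
    · exact (mix_le_mix (h'.join _) (ih hi (by omega)) (ih hi hij)).trans
        (mix_anti (huu _) (valueN_antitone h hu n hi hij (by omega) le_rfl (by omega)))
    · split_ifs
      · exact mix_le_mix h.success le_rfl (ih (by omega) le_rfl)
      · exact mix_le_mix h.success (ih (by omega) (by omega)) (ih (by omega) (by omega))

/-- The possibility that other customers renege is an advantage. -/
lemma valueN_le_value {w c : ℕ → ℝ} (h : Admissible β p q u (fun _ => 1) (fun _ => 1))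
    (hu : Antitone u) (h' : Admissible β p q u w c) {y : ℕ} (huy : u (y + 1) = 0)
    (hc : ∀ j ≤ y, c j = 1) (n : ℕ) {i j : ℕ} (hi : 1 ≤ i) (hij : i ≤ j) (hj : j ≤ y) :
    valueN β p q u n i j ≤ value β p q u w c n i j := by
  induction n generalizing i j with
  | zero => exact le_rfl
  | succ n ih =>
    rw [valueN_succ, value, bellman]
    refine mul_le_mul_of_nonneg_left (mix_le_mix h.arrival ?_ ?_) h.beta_pos.le
    -- At `j = y` nobody joins, so the induction never leaves the range where the tagged customer
    -- rejoins.
    · rcases hj.eq_or_lt with rfl | hlt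
      · rw [huy]
        simpa using ih hi hij le_rfl
      · exact mix_le_mix (h.join _) (ih hi (by omega) hlt) (ih hi hij hj)
    · split_ifs
      · rw [hc j hj, one_mul]
        exact mix_le_mix h.success le_rfl (ih (by omega) le_rfl hj)
      · have h1 := ih (i := i - 1) (j := j) (by omega) (by omega) hj
        have h2 := ih (i := i - 1) (j := j - 1) (by omega) (by omega) (by omega)
        exact mix_le_mix h.success h2 (le_mix (h'.rejoin _) h1
          ((valueN_antitone h hu n (by omega) (by omega) (by omega) le_rfl (by omega)).trans h2))

variable {f : ℕ → ℕ → ℝ}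

lemma IsValue.antitone (hf : IsValue β p q u (fun _ => 1) (fun _ => 1) f)
    (h : Admissible β p q u (fun _ => 1) (fun _ => 1)) (hu : Antitone u)
    {i j i' j' : ℕ} (hi : 1 ≤ i) (hij : i ≤ j) (hij' : i' ≤ j') (hii : i ≤ i')
    (hjj : j ≤ j') : f i' j' ≤ f i j :=
  le_of_tendsto_of_tendsto' (hf i' j') (hf i j)
    fun n => valueN_antitone h hu n hi hij hij' hii hjj

lemma IsValue.antitone_join (hf : IsValue β p q u (fun _ => 1) (fun _ => 1) f)
    (h : Admissible β p q u (fun _ => 1) (fun _ => 1)) (hu : Antitone u)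
    {u' : ℕ → ℝ} {f' : ℕ → ℕ → ℝ} (hf' : IsValue β p q u' (fun _ => 1) (fun _ => 1) f')
    (h' : Admissible β p q u' (fun _ => 1) (fun _ => 1)) (huu : u ≤ u')
    {i j : ℕ} (hi : 1 ≤ i) (hij : i ≤ j) : f' i j ≤ f i j :=
  le_of_tendsto_of_tendsto' (hf' i j) (hf i j)
    fun n => valueN_antitone_join h hu h' huu n hi hij

lemma IsValue.le_of_reneging (hf : IsValue β p q u (fun _ => 1) (fun _ => 1) f)
    (h : Admissible β p q u (fun _ => 1) (fun _ => 1)) (hu : Antitone u) {w c : ℕ → ℝ}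
    {g : ℕ → ℕ → ℝ} (hg : IsValue β p q u w c g) (h' : Admissible β p q u w c) {y : ℕ}
    (huy : u (y + 1) = 0) (hc : ∀ j ≤ y, c j = 1) {i j : ℕ} (hi : 1 ≤ i) (hij : i ≤ j)
    (hj : j ≤ y) : f i j ≤ g i j :=
  le_of_tendsto_of_tendsto' (hf i j) (hg i j)
    fun n => valueN_le_value h hu h' huy hc n hi hij hj

lemma IsValue.eq_no_reneging (hf : IsValue β p q u (fun _ => 1) (fun _ => 1) f) (i j : ℕ) :
    f i j = β * (p * (u (j + 1) * f i (j + 1) + (1 - u (j + 1)) * f i j) +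
        (1 - p) * (if i = 1 then q * 1 + (1 - q) * f j j
          else q * f (i - 1) (j - 1) + (1 - q) * f (i - 1) j)) := by
  rw [← bellman_no_reneging]
  exact hf.eq_bellman i j

/-- With discounting and failures, one more customer behind makes a difference. -/
lemma IsValue.lt_of_one_more (hf : IsValue β p q u (fun _ => 1) (fun _ => 1) f)
    (h : Admissible β p q u (fun _ => 1) (fun _ => 1)) (hu : Antitone u) (hβ : β < 1)
    (hq : q < 1) {i : ℕ} (hi : 1 ≤ i) : f i (i + 1) < f i i := by
  have hM {i j i' j' : ℕ} (hi : 1 ≤ i) (hij : i ≤ j) (hij' : i' ≤ j') (hii : i ≤ i')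
    (hjj : j ≤ j') : f i' j' ≤ f i j := hf.antitone h hu hi hij hij' hii hjj
  have harr {i i' j j' : ℕ} (hi : 1 ≤ i) (hij : i ≤ j) (hii : i ≤ i') (hij' : i' ≤ j')
      (hjj : j < j') :
      u (j' + 1) * f i' (j' + 1) + (1 - u (j' + 1)) * f i' j' ≤
        u (j + 1) * f i (j + 1) + (1 - u (j + 1)) * f i j :=
    (mix_le (h.join _) (hM (by omega) hij' (by omega) le_rfl (by omega)) le_rfl).trans
      (le_mix (h.join _) (hM hi (by omega) hij' hii hjj) (hM hi hij hij' hii hjj.le))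
  have hlt : f 1 1 < 1 := by
    have hs := h.soloValue_eq
    have h1 := h.soloValue_le_one
    refine (hf.le_soloValue h 1 1).trans_lt ?_
    rw [hs]
    refine lt_of_le_of_lt (mul_le_of_le_one_right h.beta_pos.le ?_) hβ
    exact mix_le h.arrival h1 (mix_le h.success le_rfl h1)
  -- Success pays 1 at `(1, 1)` but only leads to `f 1 1 < 1` from `(2, 2)`. A failure carries this
  -- gap to `(1, 2)` against `(1, 1)`, and successes of those in front carry it to later positions.
  have h22 : f 2 2 < f 1 1 := by
    rw [hf.eq_no_reneging 1 1, hf.eq_no_reneging 2 2]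
    refine mul_lt_mul_of_pos_left (mix_lt_mix_right h.arrival h.arrival_lt
      (harr le_rfl le_rfl (by omega) le_rfl (by omega)) ?_) h.beta_pos
    exact mix_lt_mix_left h.success h.success_pos hlt
      (hM le_rfl le_rfl (by omega) le_rfl (by omega))
  induction i, hi using Nat.le_induction with
  | base =>
    refine (hf.eq_no_reneging 1 (1 + 1)).trans_lt
      (lt_of_lt_of_eq ?_ (hf.eq_no_reneging 1 1).symm)
    refine mul_lt_mul_of_pos_left (mix_lt_mix_right h.arrival h.arrival_lt
      (harr (j := 1) (j' := 2) le_rfl le_rfl le_rfl (by omega) (by omega)) ?_) h.beta_pos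
    rw [if_pos rfl, if_pos rfl]
    exact mix_lt_mix_right h.success hq le_rfl h22
  | succ i hi ih =>
    refine (hf.eq_no_reneging (i + 1) (i + 1 + 1)).trans_lt
      (lt_of_lt_of_eq ?_ (hf.eq_no_reneging (i + 1) (i + 1)).symm)
    refine mul_lt_mul_of_pos_left (mix_lt_mix_right h.arrival h.arrival_lt
      (harr (j := i + 1) (j' := i + 2) (by omega) le_rfl le_rfl (by omega) (by omega)) ?_) h.beta_pos
    rw [if_neg (by omega), if_neg (by omega)]
    exact mix_lt_mix_left h.success h.success_pos ih
      (hM hi (by omega) (by omega) le_rfl (by omega))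

/-- With discounting and failures, joining in the last position is strictly better when customers
may renege. -/
lemma IsValue.lt_of_reneging (hf : IsValue β p q u (fun _ => 1) (fun _ => 1) f)
    (h : Admissible β p q u (fun _ => 1) (fun _ => 1)) (hu : Antitone u) (hβ : β < 1)
    (hq : q < 1) {w c : ℕ → ℝ} {g : ℕ → ℕ → ℝ} (hg : IsValue β p q u w c g)
    (h' : Admissible β p q u w c) {y : ℕ} (hy : 1 ≤ y) (huy : u (y + 2) = 0)
    (hc : ∀ j ≤ y + 1, c j = 1) (hw : w (y + 1) < 1) :
    f (y + 1) (y + 1) < g (y + 1) (y + 1) := by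
  have hle {i j : ℕ} (hi : 1 ≤ i) (hij : i ≤ j) (hj : j ≤ y + 1) : f i j ≤ g i j :=
    hf.le_of_reneging h hu hg h' huy hc hi hij hj
  rw [hf.eq_no_reneging (y + 1) (y + 1), hg.eq_bellman (y + 1) (y + 1), bellman, huy,
    if_neg (by omega), if_neg (by omega)]
  simp only [Nat.add_sub_cancel]
  have h1 := hle (by omega) le_rfl (le_refl (y + 1))
  refine mul_lt_mul_of_pos_left (mix_lt_mix_right h.arrival h.arrival_lt (by linarith)
    (mix_lt_mix_right h.success hq (hle hy le_rfl (by omega)) ?_)) h.beta_pos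
  -- With positive probability the customer whose service fails leaves, and then one customer fewer
  -- stands behind.
  have h2 := mix_lt_mix_right (h'.rejoin (y + 1)) hw (hle hy (by omega) le_rfl)
    ((hf.lt_of_one_more h hu hβ hq hy).trans_le (hle hy le_rfl (by omega)))
  exact lt_of_eq_of_lt (by ring) h2

/-- Without discounting, the reward is received with probability one. -/
lemma IsValue.eq_one_of_no_discount (hf : IsValue 1 p q u (fun _ => 1) (fun _ => 1) f)
    (h : Admissible 1 p q u (fun _ => 1) (fun _ => 1)) (hu : Antitone u) {m : ℕ} (hm : 1 ≤ m)
    (hum : u (m + 1) = 0) {i j : ℕ} (hi : 1 ≤ i) (hij : i ≤ j) (hj : j ≤ m) : f i j = 1 := by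
  have hM {i j i' j' : ℕ} (hi : 1 ≤ i) (hij : i ≤ j) (hij' : i' ≤ j') (hii : i ≤ i')
    (hjj : j ≤ j') : f i' j' ≤ f i j := hf.antitone h hu hi hij hij' hii hjj
  -- Nobody joins at level `m`, so without discounting arrivals change nothing and cancel.
  have hserv (i : ℕ) : f i m = if i = 1 then q * 1 + (1 - q) * f m m
      else q * f (i - 1) (m - 1) + (1 - q) * f (i - 1) m := by
    have h1 := hf.eq_no_reneging i m
    rw [hum] at h1
    refine mul_left_cancel₀ (sub_pos.2 h.arrival_lt).ne' ?_
    linear_combination h1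
  have hfirst (i : ℕ) (hi : 1 ≤ i) (him : i ≤ m) : f 1 m ≤ f i m := by
    induction i, hi using Nat.le_induction with
    | base => exact le_rfl
    | succ i hi ih =>
      rw [hserv (i + 1), if_neg (by omega)]
      have h1 : f i m ≤ f i (m - 1) := hM hi (by omega) (by omega) le_rfl (by omega)
      exact le_mix h.success ((ih (by omega)).trans h1) (ih (by omega))
  -- At level `m` the first position is no better than the last: `q + (1 - q) * f m m ≤ f m m`,
  -- which forces `1 ≤ f m m`.
  have h1 := hfirst m hm le_rfl
  rw [hserv 1, if_pos rfl] at h1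
  have h2 : 1 ≤ f m m := by
    have : q * 1 ≤ q * f m m := by linarith
    exact le_of_mul_le_mul_left this h.success_pos
  exact le_antisymm (hf.mem h i j).2 (h2.trans (hM hi hij le_rfl (hij.trans hj) hj))

end NoReneging

/-! ### Threshold strategies. -/

section JoinProb

lemma joinProb_of_le {x : ℝ} {i : ℕ} (h : i ≤ ⌊x⌋₊) : joinProb x i = 1 := if_pos h

lemma joinProb_floor_add_one (x : ℝ) : joinProb x (⌊x⌋₊ + 1) = x - ⌊x⌋₊ := by
  simp [joinProb]

lemma joinProb_of_ge {x : ℝ} {i : ℕ} (h : ⌊x⌋₊ + 2 ≤ i) : joinProb x i = 0 := by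
  rw [joinProb, if_neg (by omega), if_neg (by omega)]

lemma joinProb_antitone {x : ℝ} (hx : 0 ≤ x) : Antitone (joinProb x) := by
  refine antitone_nat_of_succ_le fun i => ?_
  by_cases h : i ≤ ⌊x⌋₊
  · rw [joinProb_of_le h]
    exact (joinProb_mem hx _).2
  · rw [joinProb_of_ge (by omega : ⌊x⌋₊ + 2 ≤ i + 1)]
    exact (joinProb_mem hx _).1

lemma joinProb_mono {x y : ℝ} (hx : 0 ≤ x) (hxy : x ≤ y) : joinProb x ≤ joinProb y := by
  intro i
  have hf := Nat.floor_mono hxy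
  rcases hf.eq_or_lt with h | h
  · unfold joinProb
    rw [h]
    split_ifs <;> linarith
  · by_cases hi : i ≤ ⌊y⌋₊
    · rw [joinProb_of_le hi]
      exact (joinProb_mem hx i).2
    · rw [joinProb_of_ge (by omega : ⌊x⌋₊ + 2 ≤ i)]
      exact (joinProb_mem (hx.trans hxy) i).1

lemma joinProb_floor_add_one_lt (x : ℝ) : joinProb x (⌊x⌋₊ + 1) < 1 := by
  rw [joinProb_floor_add_one]
  linarith [Nat.lt_floor_add_one x]

lemma joinProb_pos {x : ℝ} {i : ℕ} (hi : 1 ≤ i) (h : (i : ℝ) < x + 1) : 0 < joinProb x i := by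
  by_cases h1 : i ≤ ⌊x⌋₊
  · rw [joinProb_of_le h1]
    exact one_pos
  · have hx : 0 ≤ x := by
      have : (1 : ℝ) ≤ i := by exact_mod_cast hi
      linarith
    have h2 : i = ⌊x⌋₊ + 1 := by
      have h3 : ((i - 1 : ℕ) : ℝ) ≤ x := by
        rw [Nat.cast_sub hi]
        push_cast
        linarith
      have := Nat.le_floor h3
      omega
    rw [h2, joinProb_floor_add_one]
    rw [h2] at h
    push_cast at h
    linarith

lemma joinProb_eq_zero {x : ℝ} (hx : 0 ≤ x) {i : ℕ} (h : x + 1 ≤ i) : joinProb x i = 0 := by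
  have h1 := Nat.floor_le hx
  have h2 : ⌊x⌋₊ + 1 ≤ i := by
    have : (⌊x⌋₊ + 1 : ℝ) ≤ i := by linarith
    exact_mod_cast this
  rcases h2.eq_or_lt with h3 | h3
  · rw [← h3] at h
    push_cast at h
    rw [← h3, joinProb_floor_add_one]
    linarith
  · exact joinProb_of_ge h3

end JoinProb

/-! ### Signs of payoffs at an equilibrium. -/

section BestResponse

variable {payoff : ℕ → ℝ} {x : ℝ}

/-- The position is joined with positive probability, so balking (`r = 0`) must not be a gain. -/
lemma IsBestResponse.nonneg (h : IsBestResponse payoff x) {i : ℕ} (hi : 1 ≤ i)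
    (hx : (i : ℝ) < x + 1) : 0 ≤ payoff i := by
  have hle : i ≤ ⌈x⌉₊ + 1 := by
    have : (i : ℝ) < (⌈x⌉₊ + 1 : ℕ) := hx.trans_le (by push_cast; linarith [Nat.le_ceil x])
    exact (Nat.cast_lt.1 this).le
  have h0 := h i hi hle 0 (by simp)
  rw [zero_mul] at h0
  exact nonneg_of_mul_nonneg_right h0 (joinProb_pos hi hx)

/-- This position is joined with probability below one, so joining surely (`r = 1`) must not be a
gain. -/
lemma IsBestResponse.nonpos (h : IsBestResponse payoff x) : payoff (⌊x⌋₊ + 1) ≤ 0 := by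
  have h0 := h (⌊x⌋₊ + 1) (by omega) (by have := Nat.floor_le_ceil x; omega) 1 (by simp)
  have h1 := joinProb_floor_add_one_lt x
  by_contra! h2
  nlinarith

lemma IsBestResponse.congr {payoff' : ℕ → ℝ}
    (h : ∀ i, 1 ≤ i → i ≤ ⌈x⌉₊ + 1 → payoff i = payoff' i) :
    IsBestResponse payoff x ↔ IsBestResponse payoff' x := by
  unfold IsBestResponse
  refine forall_congr' fun i => forall_congr' fun hi => forall_congr' fun hi' => ?_
  rw [h i hi hi']

/-- Every threshold in `[0, 1]` is a best response to itself if the first position is worth nothing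
and the second is worth at most as much. -/
lemma isBestResponse_of_mem_Icc (hx : x ∈ Icc (0 : ℝ) 1) (h1 : payoff 1 = 0)
    (h2 : payoff 2 ≤ 0) : IsBestResponse payoff x := by
  intro i hi hi' r hr
  have hceil : ⌈x⌉₊ ≤ 1 := Nat.ceil_le.2 (by exact_mod_cast hx.2)
  obtain rfl | rfl : i = 1 ∨ i = 2 := by omega
  · simp [h1]
  · rw [joinProb_eq_zero hx.1 (by push_cast; linarith [hx.2]), zero_mul]
    exact mul_nonpos_of_nonneg_of_nonpos hr.1 h2

end BestResponse

/-! ### The recursion applied to the queue. -/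

/-- The expected reward of a customer in position `i` with `j` present, without reneging. -/
def rewardN (lam mu q α x : ℝ) (i j : ℕ) : ℝ :=
  ∫ ω, reward α (stepN lam mu q x) (.queue i j) ω ∂(pathLaw lam mu)

/-- The expected reward of a customer in position `i` with `j` present, with reneging. -/
def rewardR (lam mu q α : ℝ) (y : ℕ) (x : ℝ) (i j : ℕ) : ℝ :=
  ∫ ω, reward α (stepR lam mu q y x) (.queue i j) ω ∂(pathLaw lam mu)

variable {lam mu q α x : ℝ}

lemma arrival_mem (hlam : 0 < lam) (hmu : 0 < mu) :
    lam / (lam + mu) ∈ Ioo (0 : ℝ) 1 :=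
  ⟨by positivity, (div_lt_one (by positivity)).2 (by linarith)⟩

lemma admissible_of_mem (hlam : 0 < lam) (hmu : 0 < mu) (hq0 : 0 < q) (hq1 : q ≤ 1) (hα : 0 ≤ α)
    (hx : 0 ≤ x) {w c : ℕ → ℝ} (hw : ∀ j, w j ∈ Icc (0 : ℝ) 1) (hc : ∀ j, c j ∈ Icc (0 : ℝ) 1) :
    Admissible (meanDiscount lam mu α) (lam / (lam + mu)) q (joinProb x) w c where
  beta_pos := meanDiscount_pos (by positivity) hα
  beta_le := meanDiscount_le_one (by positivity) hα
  arrival := Ioo_subset_Icc_self (arrival_mem hlam hmu)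
  arrival_lt := (arrival_mem hlam hmu).2
  success := ⟨hq0.le, hq1⟩
  success_pos := hq0
  join := joinProb_mem hx
  rejoin := hw
  rejoin_tagged := hc

lemma admissibleN (hlam : 0 < lam) (hmu : 0 < mu) (hq0 : 0 < q) (hq1 : q ≤ 1) (hα : 0 ≤ α)
    (hx : 0 ≤ x) : Admissible (meanDiscount lam mu α) (lam / (lam + mu)) q (joinProb x)
      (fun _ => 1) (fun _ => 1) :=
  admissible_of_mem hlam hmu hq0 hq1 hα hx (by simp) (by simp)

lemma admissibleR (hlam : 0 < lam) (hmu : 0 < mu) (hq0 : 0 < q) (hq1 : q ≤ 1) (hα : 0 ≤ α)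
    (hx : 0 ≤ x) (y : ℕ) : Admissible (meanDiscount lam mu α) (lam / (lam + mu)) q (joinProb x)
      (joinProb x) (fun j => if j ≤ y then 1 else 0) :=
  admissible_of_mem hlam hmu hq0 hq1 hα hx (joinProb_mem hx)
    (fun j => by split_ifs <;> simp)

lemma isValue_rewardN (hlam : 0 < lam) (hmu : 0 < mu) (hq0 : 0 < q) (hq1 : q ≤ 1) (hα : 0 ≤ α)
    (hx : 0 ≤ x) : IsValue (meanDiscount lam mu α) (lam / (lam + mu)) q (joinProb x)
      (fun _ => 1) (fun _ => 1) (rewardN lam mu q α x) :=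
  fun i j => tendsto_value (by positivity) hα (stepN_absorbing _ _ _ _)
    (Ioo_subset_Icc_self (arrival_mem hlam hmu)) ⟨hq0.le, hq1⟩ (joinProb_mem hx)
    (stepN_hasDynamics _ _ _ _) i j

lemma isValue_rewardR (hlam : 0 < lam) (hmu : 0 < mu) (hq0 : 0 < q) (hq1 : q ≤ 1) (hα : 0 ≤ α)
    (hx : 0 ≤ x) (y : ℕ) : IsValue (meanDiscount lam mu α) (lam / (lam + mu)) q (joinProb x)
      (joinProb x) (fun j => if j ≤ y then 1 else 0) (rewardR lam mu q α y x) :=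
  fun i j => tendsto_value (by positivity) hα (stepR_absorbing _ _ _ _ _)
    (Ioo_subset_Icc_self (arrival_mem hlam hmu)) ⟨hq0.le, hq1⟩ (joinProb_mem hx)
    (stepR_hasDynamics _ _ _ _ hx) i j

lemma rewardN_le_rewardR (hlam : 0 < lam) (hmu : 0 < mu) (hq0 : 0 < q) (hq1 : q ≤ 1)
    (hα : 0 ≤ α) (hx : 0 ≤ x) {i j : ℕ} (hi : 1 ≤ i) (hij : i ≤ j) (hj : j ≤ ⌊x⌋₊ + 1) :
    rewardN lam mu q α x i j ≤ rewardR lam mu q α (⌊x⌋₊ + 1) x i j :=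
  (isValue_rewardN hlam hmu hq0 hq1 hα hx).le_of_reneging
    (admissibleN hlam hmu hq0 hq1 hα hx) (joinProb_antitone hx)
    (isValue_rewardR hlam hmu hq0 hq1 hα hx _) (admissibleR hlam hmu hq0 hq1 hα hx _)
    (joinProb_of_ge le_rfl) (fun _ hj => if_pos hj) hi hij hj

lemma rewardN_eq_rewardR_of_success (hlam : 0 < lam) (hmu : 0 < mu) (hα : 0 ≤ α) (hx : 0 ≤ x)
    (y i j : ℕ) : rewardN lam mu 1 α x i j = rewardR lam mu 1 α y x i j := by
  refine tendsto_nhds_unique (isValue_rewardN hlam hmu one_pos le_rfl hα hx i j) ?_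
  simp only [value_congr_of_success (w' := joinProb x) (c' := fun j => if j ≤ y then 1 else 0)]
  exact isValue_rewardR hlam hmu one_pos le_rfl hα hx y i j

lemma rewardN_eq_one (hlam : 0 < lam) (hmu : 0 < mu) (hq0 : 0 < q) (hq1 : q ≤ 1) (hx : 0 ≤ x)
    {i : ℕ} (hi : 1 ≤ i) (hi' : i ≤ ⌊x⌋₊ + 2) : rewardN lam mu q 0 x i i = 1 := by
  have hV := isValue_rewardN hlam hmu hq0 hq1 le_rfl hx
  have hA := admissibleN hlam hmu hq0 hq1 le_rfl hx
  rw [meanDiscount_zero (by positivity)] at hV hA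
  exact hV.eq_one_of_no_discount hA (joinProb_antitone hx) (m := ⌊x⌋₊ + 2) (by omega)
    (joinProb_of_ge (by omega)) hi le_rfl hi'

lemma rewardR_eq_one (hlam : 0 < lam) (hmu : 0 < mu) (hq0 : 0 < q) (hq1 : q ≤ 1) (hx : 0 ≤ x)
    {i : ℕ} (hi : 1 ≤ i) (hi' : i ≤ ⌊x⌋₊ + 2) :
    rewardR lam mu q 0 (⌊x⌋₊ + 1) x i i = 1 := by
  have hV := isValue_rewardR hlam hmu hq0 hq1 le_rfl hx (⌊x⌋₊ + 1)
  have hA := admissibleR hlam hmu hq0 hq1 le_rfl hx (⌊x⌋₊ + 1)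
  have hone {i : ℕ} (hi : 1 ≤ i) (hi' : i ≤ ⌊x⌋₊ + 1) :
      rewardR lam mu q 0 (⌊x⌋₊ + 1) x i i = 1 := by
    refine le_antisymm (hV.mem hA i i).2 ?_
    rw [← rewardN_eq_one hlam hmu hq0 hq1 hx hi (by omega)]
    exact rewardN_le_rewardR hlam hmu hq0 hq1 le_rfl hx hi le_rfl hi'
  -- Position `⌊x⌋₊ + 2` can be offered but lies beyond the comparison with the N-case. There the
  -- others neither join nor rejoin, so the next service leads to position `⌊x⌋₊ + 1` with nobody
  -- behind.
  rcases hi'.eq_or_lt with rfl | h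
  · have h1 := hV.eq_bellman (⌊x⌋₊ + 2) (⌊x⌋₊ + 2)
    rw [bellman, meanDiscount_zero (by positivity), joinProb_of_ge (le_refl (⌊x⌋₊ + 2)),
      joinProb_of_ge (by omega : ⌊x⌋₊ + 2 ≤ ⌊x⌋₊ + 2 + 1), if_neg (by omega)] at h1
    simp only [show ⌊x⌋₊ + 2 - 1 = ⌊x⌋₊ + 1 from rfl] at h1
    rw [hone (by omega) le_rfl] at h1
    refine mul_left_cancel₀ (sub_pos.2 hA.arrival_lt).ne' ?_
    linear_combination h1
  · exact hone hi (by omega)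

lemma payoffN_eq (lam mu q α v x : ℝ) (i : ℕ) :
    payoffN lam mu q α v x i = rewardN lam mu q α x i i - v := rfl

lemma payoffR_eq (lam mu q α v : ℝ) (y : ℕ) (x : ℝ) (i : ℕ) :
    payoffR lam mu q α v y x i = rewardR lam mu q α y x i i - v := rfl

/-- The expected reward of a customer who is always alone in the system. -/
def soloReward (lam mu q α : ℝ) : ℝ :=
  soloValue (meanDiscount lam mu α) (lam / (lam + mu)) q

lemma rewardN_le_soloReward (hlam : 0 < lam) (hmu : 0 < mu) (hq0 : 0 < q) (hq1 : q ≤ 1)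
    (hα : 0 ≤ α) (hx : 0 ≤ x) (i j : ℕ) : rewardN lam mu q α x i j ≤ soloReward lam mu q α :=
  (isValue_rewardN hlam hmu hq0 hq1 hα hx).le_soloValue (admissibleN hlam hmu hq0 hq1 hα hx) i j

lemma rewardR_le_soloReward (hlam : 0 < lam) (hmu : 0 < mu) (hq0 : 0 < q) (hq1 : q ≤ 1)
    (hα : 0 ≤ α) (hx : 0 ≤ x) (y i j : ℕ) :
    rewardR lam mu q α y x i j ≤ soloReward lam mu q α :=
  (isValue_rewardR hlam hmu hq0 hq1 hα hx y).le_soloValue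
    (admissibleR hlam hmu hq0 hq1 hα hx y) i j

lemma joinProb_two_eq_zero (hx : x ∈ Icc (0 : ℝ) 1) : joinProb x 2 = 0 :=
  joinProb_eq_zero hx.1 (by push_cast; linarith [hx.2])

lemma joinProb_two_pos (hx : 1 < x) : 0 < joinProb x 2 :=
  joinProb_pos (by omega) (by push_cast; linarith)

lemma rewardN_eq_soloReward (hlam : 0 < lam) (hmu : 0 < mu) (hq0 : 0 < q) (hq1 : q ≤ 1)
    (hα : 0 ≤ α) (hx : x ∈ Icc (0 : ℝ) 1) : rewardN lam mu q α x 1 1 = soloReward lam mu q α :=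
  (isValue_rewardN hlam hmu hq0 hq1 hα hx.1).eq_soloValue
    (admissibleN hlam hmu hq0 hq1 hα hx.1) (joinProb_two_eq_zero hx) rfl

lemma rewardR_eq_soloReward (hlam : 0 < lam) (hmu : 0 < mu) (hq0 : 0 < q) (hq1 : q ≤ 1)
    (hα : 0 ≤ α) (hx : x ∈ Icc (0 : ℝ) 1) {y : ℕ} (hy : 1 ≤ y) :
    rewardR lam mu q α y x 1 1 = soloReward lam mu q α :=
  (isValue_rewardR hlam hmu hq0 hq1 hα hx.1 y).eq_soloValue
    (admissibleR hlam hmu hq0 hq1 hα hx.1 y) (joinProb_two_eq_zero hx) (if_pos hy)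

lemma rewardN_lt_soloReward (hlam : 0 < lam) (hmu : 0 < mu) (hq0 : 0 < q) (hq1 : q < 1)
    (hα : 0 < α) (hx : 1 < x) : rewardN lam mu q α x 1 1 < soloReward lam mu q α :=
  (isValue_rewardN hlam hmu hq0 hq1.le hα.le (by linarith)).lt_soloValue
    (admissibleN hlam hmu hq0 hq1.le hα.le (by linarith))
    (meanDiscount_lt_one (by positivity) hα) hq1 (arrival_mem hlam hmu).1 (joinProb_two_pos hx)

lemma rewardR_lt_soloReward (hlam : 0 < lam) (hmu : 0 < mu) (hq0 : 0 < q) (hq1 : q < 1)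
    (hα : 0 < α) (hx : 1 < x) (y : ℕ) : rewardR lam mu q α y x 1 1 < soloReward lam mu q α :=
  (isValue_rewardR hlam hmu hq0 hq1.le hα.le (by linarith) y).lt_soloValue
    (admissibleR hlam hmu hq0 hq1.le hα.le (by linarith) y)
    (meanDiscount_lt_one (by positivity) hα) hq1 (arrival_mem hlam hmu).1 (joinProb_two_pos hx)

lemma rewardN_antitone (hlam : 0 < lam) (hmu : 0 < mu) (hq0 : 0 < q) (hq1 : q ≤ 1)
    (hα : 0 ≤ α) (hx : 0 ≤ x) {x' : ℝ} (hxx : x ≤ x') {i : ℕ} (hi : 1 ≤ i) :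
    rewardN lam mu q α x' i i ≤ rewardN lam mu q α x i i :=
  (isValue_rewardN hlam hmu hq0 hq1 hα hx).antitone_join
    (admissibleN hlam hmu hq0 hq1 hα hx) (joinProb_antitone hx)
    (isValue_rewardN hlam hmu hq0 hq1 hα (hx.trans hxx))
    (admissibleN hlam hmu hq0 hq1 hα (hx.trans hxx)) (joinProb_mono hx hxx) hi le_rfl

lemma rewardN_lt_rewardR (hlam : 0 < lam) (hmu : 0 < mu) (hq0 : 0 < q) (hq1 : q < 1)
    (hα : 0 < α) (hx : 1 ≤ x) :
    rewardN lam mu q α x (⌊x⌋₊ + 1) (⌊x⌋₊ + 1) <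
      rewardR lam mu q α (⌊x⌋₊ + 1) x (⌊x⌋₊ + 1) (⌊x⌋₊ + 1) := by
  have hx0 : 0 ≤ x := by linarith
  exact (isValue_rewardN hlam hmu hq0 hq1.le hα.le hx0).lt_of_reneging
    (admissibleN hlam hmu hq0 hq1.le hα.le hx0) (joinProb_antitone hx0)
    (meanDiscount_lt_one (by positivity) hα) hq1
    (isValue_rewardR hlam hmu hq0 hq1.le hα.le hx0 _)
    (admissibleR hlam hmu hq0 hq1.le hα.le hx0 _) (Nat.le_floor (by exact_mod_cast hx))
    (joinProb_of_ge le_rfl) (fun j hj => if_pos hj) (joinProb_floor_add_one_lt x)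

/-! ### Comparison of the equilibria. -/

theorem nashN_le_nashR {v : ℝ} (hlam : 0 < lam) (hmu : 0 < mu) (hq0 : 0 < q) (hq1 : q < 1)
    (hα : 0 < α) (hv : payoffN lam mu q α v 0 1 ≠ 0) {xN xR : ℝ}
    (hN : xN ∈ nashN lam mu q α v) (hR : xR ∈ nashR lam mu q α v) : xN ≤ xR := by
  by_contra! hlt
  obtain ⟨hN0, hN⟩ := hN
  obtain ⟨hR0, hR⟩ := hR
  have h1 : 0 ≤ payoffN lam mu q α v xN (⌊xR⌋₊ + 1) :=
    hN.nonneg (by omega) (by push_cast; linarith [Nat.floor_le hR0])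
  have h2 := hR.nonpos
  rw [payoffN_eq] at h1
  rw [payoffR_eq] at h2
  rcases le_or_gt 1 xR with hxR | hxR
  · have h3 := rewardN_antitone hlam hmu hq0 hq1.le hα.le hR0 hlt.le
      (by omega : 1 ≤ ⌊xR⌋₊ + 1)
    have h4 := rewardN_lt_rewardR hlam hmu hq0 hq1 hα hxR
    linarith
  -- In position 1 reneging gives no strict gain. Here `h2` says that `v` is at least `soloReward`,
  -- so `h1` forces equality if `xN ≤ 1` and fails if `1 < xN`.
  · rw [Nat.floor_eq_zero.2 hxR] at h1 h2
    rw [rewardR_eq_soloReward hlam hmu hq0 hq1.le hα.le ⟨hR0, hxR.le⟩ (by omega)] at h2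
    rcases le_or_gt xN 1 with hxN | hxN
    · rw [rewardN_eq_soloReward hlam hmu hq0 hq1.le hα.le ⟨hN0, hxN⟩] at h1
      refine hv ?_
      rw [payoffN_eq, rewardN_eq_soloReward hlam hmu hq0 hq1.le hα.le (by simp)]
      linarith
    · have h3 := rewardN_lt_soloReward hlam hmu hq0 hq1 hα hxN
      linarith

/-- Indifference means `v = soloReward`. Above threshold 1 the first position is joined surely at a
loss; up to 1 it is worth 0, and no position is worth more. -/
theorem nash_of_indifferent {v : ℝ} (hlam : 0 < lam) (hmu : 0 < mu) (hq0 : 0 < q) (hq1 : q < 1)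
    (hα : 0 < α) (hv : payoffN lam mu q α v 0 1 = 0) :
    nashN lam mu q α v = Icc 0 1 ∧ nashR lam mu q α v = Icc 0 1 := by
  rw [payoffN_eq, rewardN_eq_soloReward hlam hmu hq0 hq1.le hα.le (by simp)] at hv
  constructor <;> ext x <;> constructor
  · rintro ⟨hx0, hx⟩
    refine ⟨hx0, ?_⟩
    by_contra! h
    have h1 := hx.nonneg (i := 1) le_rfl (by push_cast; linarith)
    rw [payoffN_eq] at h1
    linarith [rewardN_lt_soloReward hlam hmu hq0 hq1 hα h]
  · intro hx
    refine ⟨hx.1, isBestResponse_of_mem_Icc hx ?_ ?_⟩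
    · rw [payoffN_eq, rewardN_eq_soloReward hlam hmu hq0 hq1.le hα.le hx, hv]
    · rw [payoffN_eq]
      linarith [rewardN_le_soloReward hlam hmu hq0 hq1.le hα.le hx.1 2 2]
  · rintro ⟨hx0, hx⟩
    refine ⟨hx0, ?_⟩
    by_contra! h
    have h1 := hx.nonneg (i := 1) le_rfl (by push_cast; linarith)
    rw [payoffR_eq] at h1
    linarith [rewardR_lt_soloReward hlam hmu hq0 hq1 hα h (⌊x⌋₊ + 1)]
  · intro hx
    refine ⟨hx.1, isBestResponse_of_mem_Icc hx ?_ ?_⟩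
    · rw [payoffR_eq, rewardR_eq_soloReward hlam hmu hq0 hq1.le hα.le hx (by omega), hv]
    · rw [payoffR_eq]
      linarith [rewardR_le_soloReward hlam hmu hq0 hq1.le hα.le hx.1 (⌊x⌋₊ + 1) 2 2]

theorem nashN_eq_nashR {v : ℝ} (hlam : 0 < lam) (hmu : 0 < mu) (hq0 : 0 < q) (hq1 : q ≤ 1)
    (hα : 0 ≤ α) (h : α = 0 ∨ q = 1) : nashN lam mu q α v = nashR lam mu q α v := by
  ext x
  refine and_congr_right fun hx => IsBestResponse.congr fun i hi hi' => ?_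
  rw [payoffN_eq, payoffR_eq]
  rcases h with rfl | rfl
  · have h2 : i ≤ ⌊x⌋₊ + 2 := by
      have := Nat.ceil_le_floor_add_one x
      omega
    rw [rewardN_eq_one hlam hmu hq0 hq1 hx hi h2, rewardR_eq_one hlam hmu hq0 hq1 hx hi h2]
  · rw [rewardN_eq_rewardR_of_success hlam hmu hα hx]

end FeedbackQueue

end

theorem mainTheorem3 (lam mu q α v : ℝ) (hlam : 0 < lam) (hmu : 0 < mu)
    (hq0 : 0 < q) (hq1 : q ≤ 1) (hα : 0 ≤ α) :
    -- every N-case equilibrium threshold is at most every R-case one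
    (0 < α → q < 1 → FeedbackQueue.payoffN lam mu q α v 0 1 ≠ 0 →
      ∀ xN ∈ FeedbackQueue.nashN lam mu q α v, ∀ xR ∈ FeedbackQueue.nashR lam mu q α v,
        xN ≤ xR) ∧
    -- the indifferent case: both equilibrium thresholds are the arbitrary number in `[0,1]`
    (0 < α → q < 1 → FeedbackQueue.payoffN lam mu q α v 0 1 = 0 →
      FeedbackQueue.nashN lam mu q α v = Set.Icc 0 1 ∧
      FeedbackQueue.nashR lam mu q α v = Set.Icc 0 1) ∧
    -- without discounting or without failures, the two cases have the same equilibria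
    (α = 0 ∨ q = 1 →
      FeedbackQueue.nashN lam mu q α v = FeedbackQueue.nashR lam mu q α v) ∧
    -- joining is worth at least as much in the R-case, in each position
    (∀ x : ℝ, 0 ≤ x → ∀ i : ℕ, 1 ≤ i → i ≤ ⌊x⌋₊ + 1 →
      FeedbackQueue.payoffN lam mu q α v x i ≤
        FeedbackQueue.payoffR lam mu q α v (⌊x⌋₊ + 1) x i) := by
  refine ⟨fun hα hq hv xN hN xR hR =>
    FeedbackQueue.nashN_le_nashR hlam hmu hq0 hq hα hv hN hR,
    fun hα hq hv => FeedbackQueue.nash_of_indifferent hlam hmu hq0 hq hα hv,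
    FeedbackQueue.nashN_eq_nashR hlam hmu hq0 hq1 hα, fun x hx i hi hi' => ?_⟩
  exact sub_le_sub_right
    (FeedbackQueue.rewardN_le_rewardR hlam hmu hq0 hq1 hα hx hi le_rfl hi') v
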